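/- Let $(a_n)_{n\ge 0}$ be a sequence of i.i.d. standard complex normal random variables (density $\frac1\pi e^{-|\zeta|^2}$ on $\mathbb C$). For $L>0$ let \[ f_L(z)=\sum_{n=0}^\infty a_n\left(\frac{\Gamma(L+n)}{\Gamma(n+1)\Gamma(L)}\right)^{1/2}z^n,\qquad |z|<1, \] be the hyperbolic Gaussian analytic function (the series almost surely converges in the whole unit disc), and let $n_L(r)$ be the number of zeros of $f_L$, counted with multiplicity, in the disc $D(0,r)=\{z\in\mathbb C:|z|<r\}$. Then for every $0<r<1$ the random variables $n_1(r)$ and $n_2(r)$ are square integrable, and \[ \operatorname{Var}[n_1(r)]=\frac{r^2}{1-r^4}, \qquad \operatorname{Var}[n_2(r)]=\frac{4r^2}{1-r^2}\left(\frac1{1+r^2}-\frac1{2\sqrt{1+r^4}}\right). \] -/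

import Mathlib

open MeasureTheory ProbabilityTheory

/-- The standard complex normal law on `ℂ`: the law of `x + i y`, where `x` and `y` are independent
real centred Gaussian variables of variance `1/2` (so that the expectation of `|ζ|^2` is `1`);
it has density `exp(-|ζ|^2) / π`. -/
noncomputable def stdComplexNormal : Measure ℂ :=
  ((gaussianReal 0 (1 / 2)).prod (gaussianReal 0 (1 / 2))).map (fun p : ℝ × ℝ => ⟨p.1, p.2⟩)

/-- The generalized binomial coefficient `Γ(L + n) / (Γ(n + 1) Γ(L))`. -/
noncomputable def gammaBinom (L : ℝ) (n : ℕ) : ℝ :=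
  Real.Gamma (L + n) / (Real.Gamma (n + 1) * Real.Gamma L)

/-- The power series `∑ aₙ (Γ(L + n) / (Γ(n + 1) Γ(L)))^{1/2} zⁿ` with coefficient sequence `a`.
When the `aₙ` are iid standard complex normal variables this is the hyperbolic Gaussian analytic
function of intensity `L`; it then converges almost surely at all points of the unit disc. -/
noncomputable def hyperbolicGAF (L : ℝ) (a : ℕ → ℂ) (z : ℂ) : ℂ :=
  ∑' n : ℕ, a n * (Real.sqrt (gammaBinom L n) : ℂ) * z ^ n

/-- The number of zeros of `f` in `s`, counted with multiplicity. -/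
noncomputable def zeroCount (f : ℂ → ℂ) (s : Set ℂ) : ℕ :=
  ∑ᶠ z ∈ s, analyticOrderNatAt f z

/-- `n_L(r)`: the number of zeros of the hyperbolic GAF in the open disc `D(0, r)`. -/
noncomputable def gafZeroCount {Ω : Type*} (L : ℝ) (a : ℕ → Ω → ℂ) (r : ℝ) (ω : Ω) : ℝ :=
  (zeroCount (hyperbolicGAF L (fun n => a n ω)) (Metric.ball 0 r) : ℝ)

/-! By Jensen's formula, when `f 0 ≠ 0`, the circular mean of log |f| is a piecewise linear function
of τ = log r whose left derivative is the number of zeros in the open disc. The slope of this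
function between s < r and r therefore lies between 0 and n(r), and equals n(r) once s is close to r
(`logMeanSlope_mem_Icc`, `eventually_logMeanSlope_eq`). Fatou's lemma and dominated convergence then
carry square integrability and variance from the slopes to n(r) (`variance_eq_of_tendsto`), so only
the covariances of the circular means are needed.

For standard complex normal X, Y with correlation ρ, the covariance of log |X| and log |Y| is ¼ ∑_{k
≥ 1} |ρ|^{2k} / k² (`hasSum_integral_log_mul_log`). This comes from Frullani's integral for the
logarithm and the joint Laplace transform of |X|² and |Y|². For the Gaussian function with L = ℓ +
1, |ρ|^{2k} is the power Lk of (1 - |z|²)(1 - |w|²) / |1 - z̄w|². Parseval's identity on a circle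
splits its mean into a sum of products of a function of |z| and the same function of |w|. The
centred circular means thus have covariance ∑_q w_q(log r) w_q(log s), with w_q given by
`chaosCoord` (`hasSum_integral_gafLogAverage_mul`).

The variance of a slope is then ∑_q (w_q(τ₀) - w_q(τ))² / (τ₀ - τ)², which tends to ∑_q w_q'(τ₀)²
because the latter sum is continuous (`tendsto_sum_sq_slope`). To evaluate it, put x = r², D = |1 -
x e^{iθ}|² and A = (1 - x)². A second use of Parseval and a geometric series of ratio (A/D)^L give
the circular mean of x/D for L = 1, and of 4x(1/D - 1/(D + A)) for L = 2. Both means are explicit.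
-/

/-! ### Fourier and Laplace transforms of complex normal laws -/

theorem measurable_complex_mk : Measurable (fun p : ℝ × ℝ => (⟨p.1, p.2⟩ : ℂ)) :=
  Complex.measurableEquivRealProd.symm.measurable

instance isProbabilityMeasure_stdComplexNormal : IsProbabilityMeasure stdComplexNormal := by
  unfold stdComplexNormal
  exact Measure.isProbabilityMeasure_map measurable_complex_mk.aemeasurable

theorem integral_stdComplexNormal {E : Type*} [NormedAddCommGroup E] [NormedSpace ℝ E]
    (f : ℂ → E) : ∫ x, f x ∂stdComplexNormal =
      ∫ p : ℝ × ℝ, f ⟨p.1, p.2⟩ ∂((gaussianReal 0 (1 / 2)).prod (gaussianReal 0 (1 / 2))) := by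
  have h : MeasurableEmbedding (fun p : ℝ × ℝ => (⟨p.1, p.2⟩ : ℂ)) :=
    Complex.measurableEquivRealProd.symm.measurableEmbedding
  exact h.integral_map f

theorem integral_cexp_stdComplexNormal (ξ : ℂ) :
    ∫ x, Complex.exp (((ξ * x).re : ℂ) * Complex.I) ∂stdComplexNormal =
      Complex.exp (-(‖ξ‖ ^ 2 / 4 : ℝ)) := by
  rw [integral_stdComplexNormal]
  have h1 : ∀ p : ℝ × ℝ, Complex.exp (((ξ * (⟨p.1, p.2⟩ : ℂ)).re : ℂ) * Complex.I) =
      Complex.exp (ξ.re * p.1 * Complex.I) * Complex.exp ((-ξ.im : ℝ) * p.2 * Complex.I) := by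
    intro p
    rw [← Complex.exp_add]
    congr 1
    simp [Complex.mul_re]
    ring
  simp_rw [h1]
  rw [integral_prod_mul (f := fun a : ℝ => Complex.exp (ξ.re * a * Complex.I))
    (g := fun a : ℝ => Complex.exp ((-ξ.im : ℝ) * a * Complex.I)),
    ← charFun_apply_real, ← charFun_apply_real, charFun_gaussianReal, charFun_gaussianReal,
    ← Complex.exp_add]
  congr 1
  rw [← Complex.normSq_eq_norm_sq, Complex.normSq_apply]
  push_cast
  ring

theorem integral_exp_neg_sq_gaussianReal {s : ℝ} (hs : 0 ≤ s) (c σ : ℝ) :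
    ∫ x, Real.exp (-s * (c + σ * x) ^ 2) ∂(gaussianReal 0 (1 / 2)) =
      (Real.sqrt (1 + s * σ ^ 2))⁻¹ * Real.exp (-s * c ^ 2 / (1 + s * σ ^ 2)) := by
  have hpos : 0 < 1 + s * σ ^ 2 := by positivity
  rw [integral_gaussianReal_eq_integral_smul (by norm_num)]
  have h1 : ∀ x : ℝ, gaussianPDFReal 0 (1 / 2) x • Real.exp (-s * (c + σ * x) ^ 2) =
      (Real.sqrt Real.pi)⁻¹ * Real.exp (-s * c ^ 2 / (1 + s * σ ^ 2)) *
        Real.exp (-(1 + s * σ ^ 2) * (x + s * c * σ / (1 + s * σ ^ 2)) ^ 2) := by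
    intro x
    rw [gaussianPDFReal, smul_eq_mul, mul_assoc, mul_assoc (Real.sqrt Real.pi)⁻¹, ← Real.exp_add,
      ← Real.exp_add]
    congr 2
    · congr 1
      push_cast
      ring_nf
    · push_cast
      field_simp
      ring
  simp_rw [h1]
  rw [integral_const_mul, integral_add_right_eq_self
    (fun x => Real.exp (-(1 + s * σ ^ 2) * x ^ 2)), integral_gaussian,
    Real.sqrt_div Real.pi_pos.le]
  have := Real.sqrt_pos.2 Real.pi_pos
  field_simp

theorem integral_exp_neg_normSq_stdComplexNormal {s : ℝ} (hs : 0 ≤ s) (c : ℂ) (σ : ℝ) :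
    ∫ x, Real.exp (-s * ‖c + σ * x‖ ^ 2) ∂stdComplexNormal =
      (1 + s * σ ^ 2)⁻¹ * Real.exp (-s * ‖c‖ ^ 2 / (1 + s * σ ^ 2)) := by
  have hpos : 0 < 1 + s * σ ^ 2 := by positivity
  rw [integral_stdComplexNormal]
  have h1 : ∀ p : ℝ × ℝ, Real.exp (-s * ‖c + σ * (⟨p.1, p.2⟩ : ℂ)‖ ^ 2) =
      Real.exp (-s * (c.re + σ * p.1) ^ 2) * Real.exp (-s * (c.im + σ * p.2) ^ 2) := by
    intro p
    rw [← Real.exp_add, ← Complex.normSq_eq_norm_sq, Complex.normSq_apply]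
    congr 1
    simp
    ring
  simp_rw [h1]
  rw [integral_prod_mul (f := fun a : ℝ => Real.exp (-s * (c.re + σ * a) ^ 2))
    (g := fun a : ℝ => Real.exp (-s * (c.im + σ * a) ^ 2)),
    integral_exp_neg_sq_gaussianReal hs, integral_exp_neg_sq_gaussianReal hs,
    mul_mul_mul_comm, ← Real.exp_add, ← mul_inv, Real.mul_self_sqrt hpos.le,
    ← Complex.normSq_eq_norm_sq, Complex.normSq_apply]
  congr 2
  ring

/-- The joint law of `X` and `ρ X + σ Z` for independent standard complex normal `X`, `Z`. -/
noncomputable def complexNormalPair (ρ : ℂ) (σ : ℝ) : Measure (ℂ × ℂ) :=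
  (stdComplexNormal.prod stdComplexNormal).map (fun p => (p.1, ρ * p.1 + σ * p.2))

instance isProbabilityMeasure_complexNormalPair (ρ : ℂ) (σ : ℝ) :
    IsProbabilityMeasure (complexNormalPair ρ σ) :=
  Measure.isProbabilityMeasure_map (by fun_prop)

/-- Given the first coordinate x, the second is a normal variable centred at ρx, so the inner
integral is again Gaussian in ‖x‖ and merges with the outer exponential. Only ‖ρ‖² survives, which
is why the covariance of the logarithms depends on ‖ρ‖² alone. -/
theorem integral_exp_neg_complexNormalPair {s u : ℝ} (hs : 0 ≤ s) (hu : 0 ≤ u) {ρ : ℂ} {σ : ℝ}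
    (h : ‖ρ‖ ^ 2 + σ ^ 2 = 1) :
    ∫ q, Real.exp (-s * ‖q.1‖ ^ 2 - u * ‖q.2‖ ^ 2) ∂complexNormalPair ρ σ =
      ((1 + s) * (1 + u) - ‖ρ‖ ^ 2 * (s * u))⁻¹ := by
  have hpos : 0 < 1 + u * σ ^ 2 := by positivity
  rw [complexNormalPair, integral_map (by fun_prop)
    (Measurable.aestronglyMeasurable (by fun_prop)), integral_prod]
  · have h1 : ∀ x y : ℂ, Real.exp (-s * ‖x‖ ^ 2 - u * ‖ρ * x + σ * y‖ ^ 2) =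
      Real.exp (-s * ‖x‖ ^ 2) * Real.exp (-u * ‖ρ * x + σ * y‖ ^ 2) := by
      intro x y
      rw [← Real.exp_add]
      ring_nf
    simp_rw [h1, integral_const_mul, integral_exp_neg_normSq_stdComplexNormal hu]
    have h2 : ∀ x : ℂ, Real.exp (-s * ‖x‖ ^ 2) *
        ((1 + u * σ ^ 2)⁻¹ * Real.exp (-u * ‖ρ * x‖ ^ 2 / (1 + u * σ ^ 2))) =
        (1 + u * σ ^ 2)⁻¹ *
          Real.exp (-(s + u * ‖ρ‖ ^ 2 / (1 + u * σ ^ 2)) * ‖0 + ((1 : ℝ) : ℂ) * x‖ ^ 2) := by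
      intro x
      rw [mul_left_comm, ← Real.exp_add, norm_mul]
      congr 2
      simp
      ring
    simp_rw [h2]
    rw [integral_const_mul, integral_exp_neg_normSq_stdComplexNormal (by positivity)]
    simp only [one_pow, mul_one, norm_zero, ne_eq, OfNat.ofNat_ne_zero, not_false_eq_true,
      zero_pow, mul_zero, zero_div, Real.exp_zero]
    rw [← mul_inv]
    congr 1
    have : σ ^ 2 = 1 - ‖ρ‖ ^ 2 := by linarith
    field_simp
    rw [this]
    ring
  · refine Integrable.of_bound (Measurable.aestronglyMeasurable (by fun_prop)) 1 ?_
    filter_upwards with p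
    rw [Real.norm_eq_abs, Real.abs_exp]
    exact Real.exp_le_one_iff.2 (by nlinarith [sq_nonneg ‖p.1‖, sq_nonneg ‖ρ * p.1 + σ * p.2‖])

/-! ### Square integrability of log |ζ| -/

theorem integrable_gaussianReal_abs_rpow :
    Integrable (fun x : ℝ => |x| ^ (-1 / 4 : ℝ)) (gaussianReal 0 (1 / 2)) := by
  rw [gaussianReal_of_var_ne_zero _ (by norm_num), integrable_withDensity_iff_integrable_smul'
    (by fun_prop) (by simp [gaussianPDF])]
  have h := (integrable_rpow_mul_exp_neg_mul_sq (b := 1) one_pos (s := -1 / 4) (by norm_num)).norm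
  refine (h.const_mul ((Real.sqrt Real.pi)⁻¹ * Real.sqrt 2)).mono'
    (Measurable.aestronglyMeasurable (by fun_prop)) ?_
  filter_upwards with x
  -- For negative x, `x ^ s` is `|x| ^ s * cos (s π)`. With s = -1/4 the cosine is 1/√2, so the
  -- factor √2 restores |x|^s.
  have hc : Real.sqrt 2 * Real.cos (-1 / 4 * Real.pi) = 1 := by
    rw [show -1 / 4 * Real.pi = -(Real.pi / 4) by ring, Real.cos_neg, Real.cos_pi_div_four]
    have := Real.mul_self_sqrt (show (0 : ℝ) ≤ 2 by norm_num)
    linarith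
  have hcpos : 0 < Real.cos (-1 / 4 * Real.pi) :=
    Real.cos_pos_of_mem_Ioo ⟨by linarith [Real.pi_pos], by linarith [Real.pi_pos]⟩
  have hx : |x| ^ (-1 / 4 : ℝ) ≤ Real.sqrt 2 * ‖x ^ (-1 / 4 : ℝ)‖ := by
    rcases le_or_gt 0 x with h0 | h0
    · rw [abs_of_nonneg h0, Real.norm_eq_abs, abs_of_nonneg (by positivity)]
      have : (1 : ℝ) ≤ Real.sqrt 2 := Real.one_le_sqrt.2 (by norm_num)
      nlinarith [Real.rpow_nonneg h0 (-1 / 4 : ℝ)]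
    · rw [Real.rpow_def_of_neg h0, Real.rpow_def_of_pos (abs_pos.2 h0.ne), Real.log_abs,
        Real.norm_eq_abs, abs_of_nonneg (by positivity), mul_left_comm, hc, mul_one]
  rw [norm_smul, Real.norm_eq_abs, abs_of_nonneg ENNReal.toReal_nonneg, toReal_gaussianPDF, gaussianPDFReal, norm_mul,
    Real.norm_eq_abs (|x| ^ _), abs_of_nonneg (by positivity : 0 ≤ |x| ^ (-1 / 4 : ℝ)),
    Real.norm_eq_abs (Real.exp _), Real.abs_exp]
  have e1 : -(x - 0) ^ 2 / (2 * ((1 / 2 : NNReal) : ℝ)) = -1 * x ^ 2 := by push_cast; ring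
  have e2 : 2 * Real.pi * ((1 / 2 : NNReal) : ℝ) = Real.pi := by push_cast; ring
  rw [e1, e2]
  calc _ ≤ (Real.sqrt Real.pi)⁻¹ * Real.exp (-1 * x ^ 2) *
        (Real.sqrt 2 * ‖x ^ (-1 / 4 : ℝ)‖) := by gcongr
    _ = _ := by ring

/-- The bound log t ≤ 8 t^{1/8}, applied to t and to 1/t, is squared; 128 = 2 · 8² by (a + b)² ≤
2(a² + b²). -/
theorem log_sq_le_rpow {t : ℝ} (ht : 0 < t) :
    Real.log t ^ 2 ≤ 128 * (t ^ (1 / 4 : ℝ) + t ^ (-1 / 4 : ℝ)) := by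
  have h1 := Real.log_le_rpow_div ht.le (show (0 : ℝ) < 1 / 8 by norm_num)
  have h2 := Real.log_le_rpow_div (inv_pos.2 ht).le (show (0 : ℝ) < 1 / 8 by norm_num)
  rw [Real.log_inv, Real.inv_rpow ht.le, ← Real.rpow_neg ht.le] at h2
  have e1 : t ^ (1 / 4 : ℝ) = (t ^ (1 / 8 : ℝ)) ^ 2 := by
    rw [← Real.rpow_natCast, ← Real.rpow_mul ht.le]; norm_num
  have e2 : t ^ (-1 / 4 : ℝ) = (t ^ (-(1 / 8) : ℝ)) ^ 2 := by
    rw [← Real.rpow_natCast, ← Real.rpow_mul ht.le]; norm_num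
  rw [e1, e2]
  have p1 : 0 ≤ t ^ (1 / 8 : ℝ) := by positivity
  have p2 : 0 ≤ t ^ (-(1 / 8) : ℝ) := by positivity
  have h3 : |Real.log t| ≤ 8 * (t ^ (1 / 8 : ℝ) + t ^ (-(1 / 8) : ℝ)) := by
    rw [abs_le]; constructor <;> linarith
  calc Real.log t ^ 2 = |Real.log t| ^ 2 := (sq_abs _).symm
    _ ≤ (8 * (t ^ (1 / 8 : ℝ) + t ^ (-(1 / 8) : ℝ))) ^ 2 := by gcongr
    _ ≤ _ := by nlinarith [sq_nonneg (t ^ (1 / 8 : ℝ) - t ^ (-(1 / 8) : ℝ))]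

theorem measurePreserving_re_stdComplexNormal :
    MeasurePreserving Complex.re stdComplexNormal (gaussianReal 0 (1 / 2)) := by
  refine ⟨Complex.measurable_re, ?_⟩
  rw [stdComplexNormal, Measure.map_map Complex.measurable_re measurable_complex_mk]
  exact (measurePreserving_fst (μ := gaussianReal 0 (1 / 2)) (ν := gaussianReal 0 (1 / 2))).map_eq

theorem measurePreserving_im_stdComplexNormal :
    MeasurePreserving Complex.im stdComplexNormal (gaussianReal 0 (1 / 2)) := by
  refine ⟨Complex.measurable_im, ?_⟩
  rw [stdComplexNormal, Measure.map_map Complex.measurable_im measurable_complex_mk]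
  exact (measurePreserving_snd (μ := gaussianReal 0 (1 / 2)) (ν := gaussianReal 0 (1 / 2))).map_eq

theorem ae_re_ne_zero_stdComplexNormal : ∀ᵐ x ∂stdComplexNormal, x.re ≠ 0 := by
  have : ∀ᵐ y ∂(gaussianReal 0 (1 / 2)), y ≠ 0 := by
    have := nullSingletonClass_gaussianReal (μ := 0) (v := 1 / 2) (by norm_num)
    exact Measure.ae_ne _ _
  exact measurePreserving_re_stdComplexNormal.quasiMeasurePreserving.ae this

theorem integrable_norm_stdComplexNormal :
    Integrable (fun x : ℂ => ‖x‖) stdComplexNormal := by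
  have h : Integrable (fun y : ℝ => |y|) (gaussianReal 0 (1 / 2)) :=
    ((memLp_id_gaussianReal (μ := 0) (v := 1 / 2) 1).integrable (by norm_num)).abs
  refine ((measurePreserving_re_stdComplexNormal.integrable_comp_of_integrable h).add
    (measurePreserving_im_stdComplexNormal.integrable_comp_of_integrable h)).mono'
    (by fun_prop) ?_
  filter_upwards with x
  rw [norm_norm]
  exact Complex.norm_le_abs_re_add_abs_im x

/-- The singularity at 0 is reduced to one dimension by ‖x‖^{-1/4} ≤ |Re x|^{-1/4}; the growth at
infinity is absorbed by 1 + ‖x‖. -/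
theorem integrable_log_norm_sq_stdComplexNormal :
    Integrable (fun x : ℂ => Real.log ‖x‖ ^ 2) stdComplexNormal := by
  refine (((integrable_const 1).add integrable_norm_stdComplexNormal).add
    (measurePreserving_re_stdComplexNormal.integrable_comp_of_integrable
      integrable_gaussianReal_abs_rpow)).const_mul 128 |>.mono'
    (Measurable.aestronglyMeasurable (by fun_prop)) ?_
  filter_upwards [ae_re_ne_zero_stdComplexNormal] with x hx
  have hx0 : 0 < ‖x‖ := norm_pos_iff.2 (fun h => hx (by simp [h]))
  rw [Real.norm_eq_abs, abs_of_nonneg (sq_nonneg _)]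
  refine (log_sq_le_rpow hx0).trans ?_
  simp only [Pi.add_apply, Function.comp_apply]
  have h1 : ‖x‖ ^ (1 / 4 : ℝ) ≤ 1 + ‖x‖ := by
    rcases le_or_gt 1 ‖x‖ with h | h
    · have := Real.rpow_le_rpow_of_exponent_le h (show (1 / 4 : ℝ) ≤ 1 by norm_num)
      rw [Real.rpow_one] at this
      linarith
    · have := Real.rpow_le_one hx0.le h.le (show (0 : ℝ) ≤ 1 / 4 by norm_num)
      linarith
  have h2 : ‖x‖ ^ (-1 / 4 : ℝ) ≤ |x.re| ^ (-1 / 4 : ℝ) :=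
    Real.rpow_le_rpow_of_nonpos (abs_pos.2 hx) (Complex.abs_re_le_norm x) (by norm_num)
  linarith

/-! ### Frullani's integral and covariances of logarithms -/

open Set Filter Topology

/-- The integrand of Frullani's representation of the logarithm. -/
noncomputable def frullaniKernel (t s : ℝ) : ℝ := s⁻¹ * (Real.exp (-s) - Real.exp (-(t * s)))

theorem measurable_frullaniKernel : Measurable (fun q : ℝ × ℝ => frullaniKernel q.1 q.2) := by
  unfold frullaniKernel
  fun_prop

theorem abs_exp_neg_sub_exp_neg_le {a b c : ℝ} (ha : c ≤ a) (hb : c ≤ b) :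
    |Real.exp (-a) - Real.exp (-b)| ≤ |a - b| * Real.exp (-c) := by
  wlog h : a ≤ b generalizing a b
  · rw [abs_sub_comm, abs_sub_comm a b]
    exact this hb ha (le_of_not_ge h)
  have h1 : Real.exp (-b) ≤ Real.exp (-a) := Real.exp_le_exp.2 (by linarith)
  rw [abs_of_nonneg (by linarith), abs_of_nonpos (by linarith)]
  have h2 : Real.exp (-b) = Real.exp (-a) * Real.exp (a - b) := by
    rw [← Real.exp_add]; congr 1; ring
  have h3 := Real.add_one_le_exp (a - b)
  have h4 : Real.exp (-a) ≤ Real.exp (-c) := Real.exp_le_exp.2 (by linarith)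
  have h5 := Real.exp_pos (-a)
  calc Real.exp (-a) - Real.exp (-b) = Real.exp (-a) * (1 - Real.exp (a - b)) := by rw [h2]; ring
    _ ≤ Real.exp (-a) * (-(a - b)) := by gcongr; linarith
    _ ≤ Real.exp (-c) * (-(a - b)) := by gcongr; linarith
    _ = _ := mul_comm _ _

theorem integrableOn_frullaniKernel {t : ℝ} (ht : 0 < t) :
    IntegrableOn (frullaniKernel t) (Ioi 0) := by
  have hm : 0 < min 1 t := lt_min one_pos ht
  refine Integrable.mono' ((integrableOn_exp_mul_Ioi (neg_lt_zero.2 hm) 0).const_mul |1 - t|)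
    (measurable_frullaniKernel.comp (measurable_const.prodMk measurable_id)).aestronglyMeasurable ?_
  filter_upwards [ae_restrict_mem measurableSet_Ioi] with s (hs : 0 < s)
  have := abs_exp_neg_sub_exp_neg_le (a := s) (b := t * s) (c := min 1 t * s)
    (by nlinarith [min_le_left 1 t]) (by nlinarith [min_le_right 1 t])
  rw [frullaniKernel, norm_mul, Real.norm_eq_abs, Real.norm_eq_abs, abs_inv, abs_of_pos hs]
  rw [show s - t * s = (1 - t) * s by ring, abs_mul, abs_of_pos hs] at this
  rw [inv_mul_le_iff₀ hs]
  calc _ ≤ _ := this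
    _ = _ := by rw [neg_mul]; ring

theorem integral_frullaniKernel {t : ℝ} (ht : 0 < t) :
    ∫ s in Ioi 0, frullaniKernel t s = Real.log t := by
  have h := Frullani.integral_Ioi_eq (f := fun x : ℝ => Real.exp (-x)) (a := 1) (b := t)
    (L := 1) (R := 0)
    (Continuous.locallyIntegrable (show Continuous fun x : ℝ => Real.exp (-x) by
      fun_prop) |>.locallyIntegrableOn _) one_pos ht
    ?_ (Real.tendsto_exp_atBot.comp tendsto_neg_atTop_atBot) ?_
  · simpa [frullaniKernel] using h
  · have : Tendsto (fun x : ℝ => Real.exp (-x)) (𝓝 0) (𝓝 (Real.exp (-0))) :=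
      Continuous.tendsto (by fun_prop) 0
    simpa using this.mono_left nhdsWithin_le_nhds
  · refine (integrableOn_frullaniKernel ht).congr_fun (fun s _ => ?_) measurableSet_Ioi
    simp [frullaniKernel]

/-- The kernel has constant sign on s > 0. Absolute integrability in Fubini's theorem thus costs no
more than integrability of the logarithms themselves. -/
theorem integral_abs_frullaniKernel {t : ℝ} (ht : 0 < t) :
    ∫ s in Ioi 0, |frullaniKernel t s| = |Real.log t| := by
  rcases le_total 1 t with h | h
  · rw [abs_of_nonneg (Real.log_nonneg h), ← integral_frullaniKernel ht]
    refine setIntegral_congr_fun measurableSet_Ioi fun s (hs : 0 < s) => abs_of_nonneg ?_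
    have : Real.exp (-(t * s)) ≤ Real.exp (-s) := Real.exp_le_exp.2 (by nlinarith)
    exact mul_nonneg (inv_nonneg.2 hs.le) (by linarith)
  · rw [abs_of_nonpos (Real.log_nonpos ht.le h), ← integral_frullaniKernel ht, ← integral_neg]
    refine setIntegral_congr_fun measurableSet_Ioi fun s (hs : 0 < s) => abs_of_nonpos ?_
    have : Real.exp (-s) ≤ Real.exp (-(t * s)) := Real.exp_le_exp.2 (by nlinarith)
    exact mul_nonpos_of_nonneg_of_nonpos (inv_nonneg.2 hs.le) (by linarith)

/-- A primitive is (s / (1 + s))^{k+1} / (k + 1), which goes from 0 to 1 / (k + 1). -/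
theorem integral_pow_div_one_add_pow (k : ℕ) :
    IntegrableOn (fun s : ℝ => s ^ k / (1 + s) ^ (k + 2)) (Ioi 0) ∧
      ∫ s in Ioi 0, s ^ k / (1 + s) ^ (k + 2) = (k + 1 : ℝ)⁻¹ := by
  have hd : ∀ s ∈ Ioi (0 : ℝ), HasDerivAt (fun s : ℝ => (s / (1 + s)) ^ (k + 1) / (k + 1))
      (s ^ k / (1 + s) ^ (k + 2)) s := by
    intro s (hs : 0 < s)
    have h1 : (1 + s) ≠ 0 := by positivity
    have := (((hasDerivAt_id s).div ((hasDerivAt_id s).const_add 1) h1).pow (k + 1)).div_const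
      ((k : ℝ) + 1)
    refine this.congr_deriv ?_
    have : (k : ℝ) + 1 ≠ 0 := by positivity
    simp only [id, Nat.add_sub_cancel, Nat.cast_add, Nat.cast_one, Pi.div_apply, div_pow]
    field_simp
    ring
  have hc : ContinuousWithinAt (fun s : ℝ => (s / (1 + s)) ^ (k + 1) / (k + 1)) (Ici 0) 0 := by
    refine ContinuousAt.continuousWithinAt ?_
    have : (1 + (0 : ℝ)) ≠ 0 := by norm_num
    fun_prop (disch := assumption)
  have hn : ∀ s ∈ Ioi (0 : ℝ), 0 ≤ s ^ k / (1 + s) ^ (k + 2) := by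
    intro s (hs : 0 < s); positivity
  have ht : Tendsto (fun s : ℝ => (s / (1 + s)) ^ (k + 1) / (k + 1)) atTop
      (𝓝 (1 ^ (k + 1) / (k + 1))) := by
    refine Tendsto.div_const (Tendsto.pow ?_ _) _
    have h2 : Tendsto (fun s : ℝ => 1 - (1 + s)⁻¹) atTop (𝓝 (1 - 0)) :=
      tendsto_const_nhds.sub (tendsto_inv_atTop_zero.comp (tendsto_atTop_add_const_left _ _ tendsto_id))
    rw [sub_zero] at h2
    refine h2.congr' ?_
    filter_upwards [eventually_gt_atTop 0] with s hs
    have : 1 + s ≠ 0 := by positivity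
    field_simp
    ring
  refine ⟨integrableOn_Ioi_deriv_of_nonneg hc hd hn ht, ?_⟩
  rw [integral_Ioi_of_hasDerivAt_of_nonneg hc hd hn ht]
  simp

theorem summable_pow_div_sq {p : ℝ} (h0 : 0 ≤ p) (h1 : p ≤ 1) :
    Summable (fun k : ℕ => p ^ (k + 1) / (k + 1 : ℝ) ^ 2) := by
  have h := (summable_nat_add_iff 1).2 (Real.summable_one_div_nat_pow.2 (one_lt_two))
  refine Summable.of_nonneg_of_le (fun k => by positivity) (fun k => ?_) h
  push_cast
  gcongr
  exact pow_le_one₀ h0 h1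

/-- This is the geometric series in p·su / ((1 + s)(1 + u)); the subtracted product is its zeroth
term. The remaining terms factor into a function of s and a function of u, and so can be integrated
separately. -/
theorem hasSum_inv_sub_inv {p s u : ℝ} (h0 : 0 ≤ p) (h1 : p ≤ 1) (hs : 0 < s) (hu : 0 < u) :
    HasSum (fun k : ℕ => p ^ (k + 1) * (s ^ k / (1 + s) ^ (k + 2) * (u ^ k / (1 + u) ^ (k + 2))))
      (s⁻¹ * u⁻¹ * (((1 + s) * (1 + u) - p * (s * u))⁻¹ - (1 + s)⁻¹ * (1 + u)⁻¹)) := by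
  have hq : p * (s * u) < (1 + s) * (1 + u) := by
    have : p * (s * u) ≤ 1 * (s * u) := by gcongr
    nlinarith
  have hq1 : p * (s * u) / ((1 + s) * (1 + u)) < 1 := by
    rw [div_lt_one (by positivity)]; exact hq
  have h := (hasSum_geometric_of_lt_one (by positivity) hq1).mul_left
    (p / ((1 + s) * (1 + u)) ^ 2)
  have hne : (1 + s) * (1 + u) - p * (s * u) ≠ 0 := (sub_pos.2 hq).ne'
  convert! h using 1
  · ext k
    have ha : 1 + s ≠ 0 := by positivity
    have hb : 1 + u ≠ 0 := by positivity
    generalize 1 + s = a at ha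
    generalize 1 + u = b at hb
    rw [div_pow, mul_pow, mul_pow, mul_pow]
    field_simp
    ring
  · rw [one_sub_div (by positivity), inv_div]
    obtain ⟨D, hD⟩ : ∃ D, D = (1 + s) * (1 + u) - p * (s * u) := ⟨_, rfl⟩
    rw [← hD] at hne ⊢
    field_simp
    rw [hD]
    ring

/-- Positive random variables whose joint Laplace transform is that of the squared moduli of
two jointly Gaussian standard complex variables with squared correlation `p`. -/
theorem hasSum_covariance_log {Ω : Type*} [MeasurableSpace Ω] {P : Measure Ω}
    [IsProbabilityMeasure P] {A B : Ω → ℝ} (hA : Measurable A) (hB : Measurable B)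
    (hA0 : ∀ᵐ ω ∂P, 0 < A ω) (hB0 : ∀ᵐ ω ∂P, 0 < B ω)
    (hlA : MemLp (fun ω => Real.log (A ω)) 2 P) (hlB : MemLp (fun ω => Real.log (B ω)) 2 P)
    {p : ℝ} (h0 : 0 ≤ p) (h1 : p ≤ 1)
    (hlap : ∀ s u : ℝ, 0 ≤ s → 0 ≤ u → ∫ ω, Real.exp (-s * A ω - u * B ω) ∂P =
      ((1 + s) * (1 + u) - p * (s * u))⁻¹) :
    HasSum (fun k : ℕ => p ^ (k + 1) / (k + 1 : ℝ) ^ 2)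
      (∫ ω, Real.log (A ω) * Real.log (B ω) ∂P -
        (∫ ω, Real.log (A ω) ∂P) * ∫ ω, Real.log (B ω) ∂P) := by
  set ν : Measure ℝ := volume.restrict (Ioi 0) with hν
  have hlog : ∀ C : Ω → ℝ, Measurable C → (∀ᵐ ω ∂P, 0 < C ω) →
      MemLp (fun ω => Real.log (C ω)) 2 P →
      Integrable (fun q : Ω × ℝ => frullaniKernel (C q.1) q.2) (P.prod ν) := by
    intro C hC hC0 hCl
    rw [integrable_prod_iff]
    · refine ⟨hC0.mono fun ω h => integrableOn_frullaniKernel h, ?_⟩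
      refine (hCl.integrable one_le_two).abs.congr (hC0.mono fun ω h => ?_)
      simp_rw [Real.norm_eq_abs]
      exact (integral_abs_frullaniKernel h).symm
    · exact (measurable_frullaniKernel.comp
        ((hC.comp measurable_fst).prodMk measurable_snd)).aestronglyMeasurable
  have hsingle : ∀ C : Ω → ℝ, Measurable C → (∀ᵐ ω ∂P, 0 < C ω) →
      MemLp (fun ω => Real.log (C ω)) 2 P →
      ∫ ω, Real.log (C ω) ∂P = ∫ s, ∫ ω, frullaniKernel (C ω) s ∂P ∂ν := by
    intro C hC hC0 hCl
    rw [← integral_integral_swap (hlog C hC hC0 hCl)]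
    exact integral_congr_ae (hC0.mono fun ω h => (integral_frullaniKernel h).symm)
  -- The integral of the absolute value over both Frullani variables is |log A| |log B|, which is
  -- integrable because both logarithms are in L².
  have hjoint : Integrable (fun q : Ω × (ℝ × ℝ) =>
      frullaniKernel (A q.1) q.2.1 * frullaniKernel (B q.1) q.2.2) (P.prod (ν.prod ν)) := by
    rw [integrable_prod_iff]
    · constructor
      · filter_upwards [hA0, hB0] with ω ha hb
        exact (integrableOn_frullaniKernel ha).mul_prod (integrableOn_frullaniKernel hb)
      · refine (MemLp.integrable_mul hlA.abs hlB.abs).congr ?_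
        filter_upwards [hA0, hB0] with ω ha hb
        simp_rw [norm_mul, Real.norm_eq_abs]
        rw [integral_prod_mul (fun s => |frullaniKernel (A ω) s|)
          (fun s => |frullaniKernel (B ω) s|)]
        rw [integral_abs_frullaniKernel ha, integral_abs_frullaniKernel hb]
        rfl
    · exact ((measurable_frullaniKernel.comp
        ((hA.comp measurable_fst).prodMk (measurable_fst.comp measurable_snd))).mul
        (measurable_frullaniKernel.comp
        ((hB.comp measurable_fst).prodMk (measurable_snd.comp measurable_snd)))).aestronglyMeasurable
  have hprod : ∫ ω, Real.log (A ω) * Real.log (B ω) ∂P =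
      ∫ q : ℝ × ℝ, ∫ ω, frullaniKernel (A ω) q.1 * frullaniKernel (B ω) q.2 ∂P ∂(ν.prod ν) := by
    rw [← integral_integral_swap hjoint]
    refine integral_congr_ae ?_
    filter_upwards [hA0, hB0] with ω ha hb
    rw [integral_prod_mul (frullaniKernel (A ω)) (frullaniKernel (B ω)),
      integral_frullaniKernel ha, integral_frullaniKernel hb]
  have hEA : ∀ s, 0 ≤ s → ∫ ω, Real.exp (-(A ω * s)) ∂P = (1 + s)⁻¹ := by
    intro s hs
    have := hlap s 0 hs le_rfl
    simp only [zero_mul, sub_zero, add_zero, mul_one, mul_zero] at this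
    rw [← this]
    congr with ω
    ring_nf
  have hEB : ∀ s, 0 ≤ s → ∫ ω, Real.exp (-(B ω * s)) ∂P = (1 + s)⁻¹ := by
    intro s hs
    have := hlap 0 s le_rfl hs
    simp only [zero_mul, sub_zero, add_zero, one_mul, mul_zero, neg_zero, zero_sub] at this
    rw [← this]
    congr with ω
    ring_nf
  have hbd : ∀ C : Ω → ℝ, Measurable C → (∀ᵐ ω ∂P, 0 < C ω) →
      ∀ s, 0 ≤ s → Integrable (fun ω => Real.exp (-(C ω * s))) P := by
    intro C hC hC0 s hs
    refine Integrable.of_bound (Measurable.aestronglyMeasurable (by fun_prop)) 1 ?_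
    filter_upwards [hC0] with ω h
    rw [Real.norm_eq_abs, Real.abs_exp]
    exact Real.exp_le_one_iff.2 (by nlinarith)
  have hbd2 : ∀ s u, 0 ≤ s → 0 ≤ u →
      Integrable (fun ω => Real.exp (-(A ω * s)) * Real.exp (-(B ω * u))) P := by
    intro s u hs hu
    refine Integrable.of_bound (Measurable.aestronglyMeasurable (by fun_prop)) 1 ?_
    filter_upwards [hA0, hB0] with ω ha hb
    rw [Real.norm_eq_abs, ← Real.exp_add, Real.abs_exp]
    exact Real.exp_le_one_iff.2 (by nlinarith)
  have hkey : ∀ᵐ q ∂(ν.prod ν), 0 < q.1 ∧ 0 < q.2 := by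
    rw [hν, Measure.prod_restrict]
    exact ae_restrict_mem (measurableSet_Ioi.prod measurableSet_Ioi)
  have hint1 : Integrable (fun q : ℝ × ℝ =>
      ∫ ω, frullaniKernel (A ω) q.1 * frullaniKernel (B ω) q.2 ∂P) (ν.prod ν) :=
    hjoint.integral_prod_right
  have hint2 : Integrable (fun q : ℝ × ℝ => (∫ ω, frullaniKernel (A ω) q.1 ∂P) *
      ∫ ω, frullaniKernel (B ω) q.2 ∂P) (ν.prod ν) :=
    (hlog A hA hA0 hlA).integral_prod_right.mul_prod (hlog B hB hB0 hlB).integral_prod_right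
  -- In the difference all terms involving e^{-s} or e^{-u} cancel. What is left is the joint
  -- Laplace transform minus the product of the marginal ones.
  have hdiff : ∫ ω, Real.log (A ω) * Real.log (B ω) ∂P -
        (∫ ω, Real.log (A ω) ∂P) * ∫ ω, Real.log (B ω) ∂P =
      ∫ q : ℝ × ℝ, q.1⁻¹ * q.2⁻¹ * (((1 + q.1) * (1 + q.2) - p * (q.1 * q.2))⁻¹ -
        (1 + q.1)⁻¹ * (1 + q.2)⁻¹) ∂(ν.prod ν) := by
    rw [hprod, hsingle A hA hA0 hlA, hsingle B hB hB0 hlB, ← integral_prod_mul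
      (fun s => ∫ ω, frullaniKernel (A ω) s ∂P) (fun s => ∫ ω, frullaniKernel (B ω) s ∂P),
      ← integral_sub hint1 hint2]
    refine integral_congr_ae (hkey.mono ?_)
    rintro ⟨s, u⟩ ⟨hs, hu⟩
    simp only at hs hu ⊢
    have e1 : ∀ ω, frullaniKernel (A ω) s * frullaniKernel (B ω) u =
        s⁻¹ * u⁻¹ * (Real.exp (-s) * Real.exp (-u) - Real.exp (-s) * Real.exp (-(B ω * u)) -
          Real.exp (-u) * Real.exp (-(A ω * s)) +
          Real.exp (-(A ω * s)) * Real.exp (-(B ω * u))) := by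
      intro ω; unfold frullaniKernel; ring
    have i1 := hbd A hA hA0 s hs.le
    have i2 := hbd B hB hB0 u hu.le
    have i3 := hbd2 s u hs.le hu.le
    have i4 : Integrable (fun ω => Real.exp (-s) * Real.exp (-u) -
        Real.exp (-s) * Real.exp (-(B ω * u))) P := (integrable_const _).sub (i2.const_mul _)
    have i5 : Integrable (fun ω => Real.exp (-s) * Real.exp (-u) -
        Real.exp (-s) * Real.exp (-(B ω * u)) - Real.exp (-u) * Real.exp (-(A ω * s))) P :=
      i4.sub (i1.const_mul _)
    have e2 : ∫ ω, Real.exp (-(A ω * s)) * Real.exp (-(B ω * u)) ∂P =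
        ((1 + s) * (1 + u) - p * (s * u))⁻¹ := by
      rw [← hlap s u hs.le hu.le]
      congr with ω
      rw [← Real.exp_add]
      ring_nf
    simp_rw [e1]
    rw [integral_const_mul, integral_add i5 i3,
      integral_sub i4 (i1.const_mul _), integral_sub (integrable_const _) (i2.const_mul _), integral_const_mul,
      integral_const_mul, integral_const_mul, e2, hEA s hs.le, hEB u hu.le]
    unfold frullaniKernel
    rw [integral_const_mul, integral_const_mul, integral_sub (integrable_const _) i1,
      integral_sub (integrable_const _) i2, hEA s hs.le, hEB u hu.le]
    simp only [integral_const, probReal_univ, one_smul]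
    ring
  rw [hdiff]
  have hterm : ∀ k : ℕ, Integrable (fun q : ℝ × ℝ => p ^ (k + 1) *
      (q.1 ^ k / (1 + q.1) ^ (k + 2) * (q.2 ^ k / (1 + q.2) ^ (k + 2)))) (ν.prod ν) := fun k =>
    ((integral_pow_div_one_add_pow k).1.mul_prod (integral_pow_div_one_add_pow k).1).const_mul _
  have hval : ∀ k : ℕ, ∫ q : ℝ × ℝ, p ^ (k + 1) *
      (q.1 ^ k / (1 + q.1) ^ (k + 2) * (q.2 ^ k / (1 + q.2) ^ (k + 2))) ∂(ν.prod ν) =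
      p ^ (k + 1) / (k + 1 : ℝ) ^ 2 := by
    intro k
    rw [integral_const_mul, integral_prod_mul (fun s : ℝ => s ^ k / (1 + s) ^ (k + 2))
      (fun s : ℝ => s ^ k / (1 + s) ^ (k + 2)), (integral_pow_div_one_add_pow k).2]
    rw [div_eq_mul_inv, sq, mul_inv]
  have hnorm : ∀ k : ℕ, ∫ q : ℝ × ℝ, ‖p ^ (k + 1) *
      (q.1 ^ k / (1 + q.1) ^ (k + 2) * (q.2 ^ k / (1 + q.2) ^ (k + 2)))‖ ∂(ν.prod ν) =
      p ^ (k + 1) / (k + 1 : ℝ) ^ 2 := by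
    intro k
    rw [← hval k]
    refine integral_congr_ae (hkey.mono ?_)
    rintro ⟨s, u⟩ ⟨hs, hu⟩
    simp only at hs hu ⊢
    rw [Real.norm_of_nonneg (by positivity)]
  -- The terms are nonnegative almost everywhere, so their norms have the same integrals, and these
  -- are summable even at p = 1.
  have h := hasSum_integral_of_summable_integral_norm hterm
    (by simp_rw [hnorm]; exact summable_pow_div_sq h0 h1)
  simp_rw [hval] at h
  convert! h using 1
  refine integral_congr_ae (hkey.mono ?_)
  rintro ⟨s, u⟩ ⟨hs, hu⟩
  exact (hasSum_inv_sub_inv h0 h1 hs hu).tsum_eq.symm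

/-! ### Covariance of log-moduli of a correlated pair -/

open scoped ComplexConjugate

theorem integral_cexp_complexNormalPair (ρ : ℂ) (σ : ℝ) (ξ η : ℂ) :
    ∫ q, Complex.exp (((ξ * q.1 + η * q.2).re : ℂ) * Complex.I) ∂complexNormalPair ρ σ =
      Complex.exp (-((‖ξ + η * ρ‖ ^ 2 + ‖η‖ ^ 2 * σ ^ 2) / 4 : ℝ)) := by
  rw [complexNormalPair, integral_map (by fun_prop)
    (Measurable.aestronglyMeasurable (by fun_prop))]
  have h1 : ∀ p : ℂ × ℂ,
      Complex.exp (((ξ * p.1 + η * (ρ * p.1 + σ * p.2)).re : ℂ) * Complex.I) =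
      Complex.exp ((((ξ + η * ρ) * p.1).re : ℂ) * Complex.I) *
        Complex.exp ((((η * σ) * p.2).re : ℂ) * Complex.I) := by
    intro p
    rw [← Complex.exp_add, ← add_mul, ← Complex.ofReal_add, ← Complex.add_re]
    congr 4
    ring
  simp_rw [h1]
  rw [integral_prod_mul (fun x : ℂ => Complex.exp ((((ξ + η * ρ) * x).re : ℂ) * Complex.I))
    (fun x : ℂ => Complex.exp ((((η * σ) * x).re : ℂ) * Complex.I)),
    integral_cexp_stdComplexNormal, integral_cexp_stdComplexNormal, ← Complex.exp_add, norm_mul,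
    Complex.norm_real, Real.norm_eq_abs, mul_pow, sq_abs]
  congr 1
  push_cast
  ring

theorem exists_eq_re_mul (L : ℂ × ℂ →L[ℝ] ℝ) :
    ∃ ξ η : ℂ, ∀ q, L q = (ξ * q.1 + η * q.2).re := by
  refine ⟨⟨L (1, 0), -L (Complex.I, 0)⟩, ⟨L (0, 1), -L (0, Complex.I)⟩, fun q => ?_⟩
  have h : q = q.1.re • ((1 : ℂ), (0 : ℂ)) + q.1.im • (Complex.I, (0 : ℂ)) +
      q.2.re • ((0 : ℂ), (1 : ℂ)) + q.2.im • ((0 : ℂ), Complex.I) := by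
    ext <;> simp
  conv_lhs => rw [h]
  simp only [map_add, map_smul, smul_eq_mul, Complex.add_re, Complex.mul_re]
  ring

/-- Every real linear functional on ℂ × ℂ is the real part of a complex linear form, so these
integrals are all the values of the characteristic function. -/
theorem measure_ext_of_integral_cexp {μ ν : Measure (ℂ × ℂ)} [IsFiniteMeasure μ]
    [IsFiniteMeasure ν]
    (h : ∀ ξ η : ℂ, ∫ q, Complex.exp (((ξ * q.1 + η * q.2).re : ℂ) * Complex.I) ∂μ =
      ∫ q, Complex.exp (((ξ * q.1 + η * q.2).re : ℂ) * Complex.I) ∂ν) : μ = ν := by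
  refine Measure.ext_of_charFunDual ?_
  ext L
  obtain ⟨ξ, η, hL⟩ := exists_eq_re_mul L
  rw [charFunDual_apply, charFunDual_apply]
  simp_rw [hL]
  exact h ξ η

theorem map_fst_complexNormalPair (ρ : ℂ) (σ : ℝ) :
    (complexNormalPair ρ σ).map Prod.fst = stdComplexNormal := by
  rw [complexNormalPair, Measure.map_map measurable_fst (by fun_prop)]
  exact (measurePreserving_fst (μ := stdComplexNormal) (ν := stdComplexNormal)).map_eq

/-- The construction of the pair is asymmetric, but its characteristic function is symmetric up to
conjugating ρ. This yields the second marginal from the first. -/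
theorem map_swap_complexNormalPair {ρ : ℂ} {σ : ℝ} (h : ‖ρ‖ ^ 2 + σ ^ 2 = 1) :
    (complexNormalPair ρ σ).map Prod.swap = complexNormalPair (conj ρ) σ := by
  have : IsProbabilityMeasure ((complexNormalPair ρ σ).map Prod.swap) :=
    Measure.isProbabilityMeasure_map (by fun_prop)
  refine measure_ext_of_integral_cexp fun ξ η => ?_
  rw [integral_map (by fun_prop) (Measurable.aestronglyMeasurable (by fun_prop)),
    integral_cexp_complexNormalPair]
  simp only [Prod.fst_swap, Prod.snd_swap]
  simp_rw [add_comm (ξ * _)]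
  rw [integral_cexp_complexNormalPair]
  congr 3
  have hσ : σ ^ 2 = 1 - ‖ρ‖ ^ 2 := by linarith
  rw [hσ]
  simp only [← Complex.normSq_eq_norm_sq, Complex.normSq_apply, Complex.add_re, Complex.add_im,
    Complex.mul_re, Complex.mul_im, Complex.conj_re, Complex.conj_im]
  ring

theorem map_snd_complexNormalPair {ρ : ℂ} {σ : ℝ} (h : ‖ρ‖ ^ 2 + σ ^ 2 = 1) :
    (complexNormalPair ρ σ).map Prod.snd = stdComplexNormal := by
  rw [← map_fst_complexNormalPair (conj ρ) σ, ← map_swap_complexNormalPair h,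
    Measure.map_map measurable_fst measurable_swap]
  rfl

theorem ae_ne_zero_stdComplexNormal : ∀ᵐ x ∂stdComplexNormal, x ≠ 0 :=
  ae_re_ne_zero_stdComplexNormal.mono fun x hx h => hx (by simp [h])

theorem memLp_log_norm_stdComplexNormal :
    MemLp (fun x : ℂ => Real.log ‖x‖) 2 stdComplexNormal :=
  (memLp_two_iff_integrable_sq (Measurable.aestronglyMeasurable (by fun_prop))).2
    integrable_log_norm_sq_stdComplexNormal

/-- The mean of `log ‖ζ‖` for a standard complex normal `ζ`. -/
noncomputable def logNormMean : ℝ := ∫ x, Real.log ‖x‖ ∂stdComplexNormal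

/-- The covariance formula is applied to the squared moduli, whose Laplace transform is rational.
Since log ‖x‖² = 2 log ‖x‖, passing back to moduli divides by 4. -/
theorem hasSum_integral_log_mul_log {ρ : ℂ} {σ : ℝ} (h : ‖ρ‖ ^ 2 + σ ^ 2 = 1) :
    HasSum (fun k : ℕ => (‖ρ‖ ^ 2) ^ (k + 1) / (4 * (k + 1 : ℝ) ^ 2))
      (∫ q, (Real.log ‖q.1‖ - logNormMean) * (Real.log ‖q.2‖ - logNormMean)
        ∂complexNormalPair ρ σ) := by
  have m1 : MeasurePreserving Prod.fst (complexNormalPair ρ σ) stdComplexNormal :=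
    ⟨measurable_fst, map_fst_complexNormalPair ρ σ⟩
  have m2 : MeasurePreserving Prod.snd (complexNormalPair ρ σ) stdComplexNormal :=
    ⟨measurable_snd, map_snd_complexNormalPair h⟩
  have l1 : MemLp (fun q : ℂ × ℂ => Real.log ‖q.1‖) 2 (complexNormalPair ρ σ) :=
    memLp_log_norm_stdComplexNormal.comp_measurePreserving m1
  have l2 : MemLp (fun q : ℂ × ℂ => Real.log ‖q.2‖) 2 (complexNormalPair ρ σ) :=
    memLp_log_norm_stdComplexNormal.comp_measurePreserving m2
  have e1 : ∫ q, Real.log ‖q.1‖ ∂complexNormalPair ρ σ = logNormMean := by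
    rw [logNormMean, ← m1.map_eq, integral_map (by fun_prop)
      (Measurable.aestronglyMeasurable (by fun_prop))]
  have e2 : ∫ q, Real.log ‖q.2‖ ∂complexNormalPair ρ σ = logNormMean := by
    rw [logNormMean, ← m2.map_eq, integral_map (by fun_prop)
      (Measurable.aestronglyMeasurable (by fun_prop))]
  have hlog : ∀ x : ℂ, Real.log (‖x‖ ^ 2) = 2 * Real.log ‖x‖ := fun x => by
    rw [Real.log_pow]; norm_num
  have key := hasSum_covariance_log (P := complexNormalPair ρ σ) (A := fun q => ‖q.1‖ ^ 2)
    (B := fun q => ‖q.2‖ ^ 2) (by fun_prop) (by fun_prop)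
    ((m1.quasiMeasurePreserving.ae ae_ne_zero_stdComplexNormal).mono fun q hq => by
      have := norm_pos_iff.2 hq; positivity)
    ((m2.quasiMeasurePreserving.ae ae_ne_zero_stdComplexNormal).mono fun q hq => by
      have := norm_pos_iff.2 hq; positivity)
    (by simp_rw [hlog]; exact l1.const_mul 2) (by simp_rw [hlog]; exact l2.const_mul 2)
    (p := ‖ρ‖ ^ 2) (by positivity) (by nlinarith [sq_nonneg σ])
    (fun s u hs hu => integral_exp_neg_complexNormalPair hs hu h)
  simp_rw [hlog, integral_const_mul] at key
  rw [e1, e2] at key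
  have e3 : ∫ q, (Real.log ‖q.1‖ - logNormMean) * (Real.log ‖q.2‖ - logNormMean)
        ∂complexNormalPair ρ σ =
      ∫ q, Real.log ‖q.1‖ * Real.log ‖q.2‖ ∂complexNormalPair ρ σ - logNormMean * logNormMean := by
    have i1 := l1.integrable one_le_two
    have i2 := l2.integrable one_le_two
    have i3 : Integrable (fun q => Real.log ‖q.1‖ * Real.log ‖q.2‖) (complexNormalPair ρ σ) :=
      MemLp.integrable_mul l1 l2
    have : ∀ q : ℂ × ℂ, (Real.log ‖q.1‖ - logNormMean) * (Real.log ‖q.2‖ - logNormMean) =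
      Real.log ‖q.1‖ * Real.log ‖q.2‖ - logNormMean * Real.log ‖q.1‖
        - (logNormMean * Real.log ‖q.2‖ - logNormMean * logNormMean) := fun q => by ring
    simp_rw [this]
    have i4 : Integrable (fun q => Real.log ‖q.1‖ * Real.log ‖q.2‖ -
      logNormMean * Real.log ‖q.1‖) (complexNormalPair ρ σ) := i3.sub (i1.const_mul _)
    have i5 : Integrable (fun q : ℂ × ℂ => logNormMean * Real.log ‖q.2‖ -
      logNormMean * logNormMean) (complexNormalPair ρ σ) :=
        (i2.const_mul _).sub (integrable_const _)
    rw [integral_sub i4 i5, integral_sub i3 (i1.const_mul _),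
      integral_sub (i2.const_mul _) (integrable_const _), integral_const_mul, integral_const_mul,
      e1, e2]
    simp
  rw [e3]
  have hm : ∀ q : ℂ × ℂ, 2 * Real.log ‖q.1‖ * (2 * Real.log ‖q.2‖) =
      4 * (Real.log ‖q.1‖ * Real.log ‖q.2‖) := fun q => by ring
  simp_rw [hm, integral_const_mul] at key
  convert! key.mul_left (1 / 4) using 1
  · ext k
    rw [mul_comm (4 : ℝ), ← div_div]
    ring
  · ring

/-! ### Joint law of two Gaussian series -/

section Series

variable {Ω : Type*} [MeasurableSpace Ω] {P : Measure Ω} {a : ℕ → Ω → ℂ}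

theorem integral_cexp_sum_range (hlaw : ∀ n, HasLaw (a n) stdComplexNormal P)
    (hindep : iIndepFun a P) (d : ℕ → ℂ) (N : ℕ) :
    ∫ ω, Complex.exp (((∑ n ∈ Finset.range N, a n ω * d n).re : ℂ) * Complex.I) ∂P =
      Complex.exp (-((∑ n ∈ Finset.range N, ‖d n‖ ^ 2) / 4 : ℝ)) := by
  have hi : iIndepFun (fun i : Fin N => a i) P := hindep.precomp Fin.val_injective
  have h1 : ∀ ω, Complex.exp (((∑ n ∈ Finset.range N, a n ω * d n).re : ℂ) * Complex.I) =
      ∏ i : Fin N, Complex.exp (((d i * a i ω).re : ℂ) * Complex.I) := by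
    intro ω
    rw [← Complex.exp_sum, Finset.sum_range, Complex.re_sum, Complex.ofReal_sum, Finset.sum_mul]
    simp_rw [mul_comm (a _ ω)]
  simp_rw [h1]
  rw [hi.integral_fun_prod_comp (f := fun (i : Fin N) x =>
      Complex.exp (((d i * x).re : ℂ) * Complex.I)) (fun i => (hlaw i).aemeasurable)
    (fun i => Measurable.aestronglyMeasurable (by fun_prop))]
  have h2 : ∀ i : Fin N, ∫ ω, Complex.exp (((d i * a i ω).re : ℂ) * Complex.I) ∂P =
      Complex.exp (-(‖d i‖ ^ 2 / 4 : ℝ)) := by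
    intro i
    rw [← integral_cexp_stdComplexNormal, ← (hlaw i).map_eq, integral_map (hlaw i).aemeasurable
      (Measurable.aestronglyMeasurable (by fun_prop))]
  simp_rw [h2]
  rw [← Complex.exp_sum, Finset.sum_range]
  congr 1
  push_cast
  rw [Finset.sum_neg_distrib, Finset.sum_div]

/-- The characteristic function of the partial sums is explicit by independence and passes to the
limit by dominated convergence. With X as first coordinate, the correlation is E[X̄Y] = ∑ conj(dₙ)
eₙ, which fixes the side of the conjugation. -/
theorem hasLaw_gaussianSeries_pair [IsProbabilityMeasure P] (hlaw : ∀ n, HasLaw (a n) stdComplexNormal P)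
    (hindep : iIndepFun a P) {d e : ℕ → ℂ} {X Y : Ω → ℂ}
    (hX : ∀ᵐ ω ∂P, HasSum (fun n => a n ω * d n) (X ω))
    (hY : ∀ᵐ ω ∂P, HasSum (fun n => a n ω * e n) (Y ω))
    {ρ : ℂ} {σ : ℝ} (hσ : ‖ρ‖ ^ 2 + σ ^ 2 = 1)
    (hd : HasSum (fun n => ‖d n‖ ^ 2) 1) (he : HasSum (fun n => ‖e n‖ ^ 2) 1)
    (hρ : HasSum (fun n => conj (d n) * e n) ρ) :
    HasLaw (fun ω => (X ω, Y ω)) (complexNormalPair ρ σ) P := by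
  have hmeas : ∀ {d : ℕ → ℂ} {X : Ω → ℂ}, (∀ᵐ ω ∂P, HasSum (fun n => a n ω * d n) (X ω)) →
      AEMeasurable X P := by
    intro d X hX
    refine aemeasurable_of_tendsto_metrizable_ae' (f := fun N ω =>
      ∑ n ∈ Finset.range N, a n ω * d n) (fun N => ?_) (hX.mono fun ω h => h.tendsto_sum_nat)
    exact Finset.aemeasurable_fun_sum _ fun n _ => (hlaw n).aemeasurable.mul_const _
  have hXm := hmeas hX
  have hYm := hmeas hY
  refine ⟨hXm.prodMk hYm, ?_⟩
  have := Measure.isProbabilityMeasure_map (hXm.prodMk hYm)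
  refine measure_ext_of_integral_cexp fun ξ η => ?_
  rw [integral_map (hXm.prodMk hYm) (Measurable.aestronglyMeasurable (by fun_prop)),
    integral_cexp_complexNormalPair]
  -- Expanding the square gives ‖ξ‖² + ‖η‖² + 2 Re(conj(ξ) η ρ); the relation ‖ρ‖² + σ² = 1 turns
  -- this into the exponent of the pair law.
  have hs : HasSum (fun n => ‖ξ * d n + η * e n‖ ^ 2) (‖ξ + η * ρ‖ ^ 2 + ‖η‖ ^ 2 * σ ^ 2) := by
    have h1 := (hd.mul_left (‖ξ‖ ^ 2)).add (he.mul_left (‖η‖ ^ 2))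
    have h2 := (Complex.hasSum_re (hρ.mul_left (conj ξ * η))).mul_left 2
    convert! h1.add h2 using 1
    · ext n
      simp only [← Complex.normSq_eq_norm_sq, Complex.normSq_apply, Complex.add_re, Complex.add_im,
        Complex.mul_re, Complex.mul_im, Complex.conj_re, Complex.conj_im]
      ring
    · have hσ : σ ^ 2 = 1 - ‖ρ‖ ^ 2 := by linarith
      rw [hσ]
      simp only [← Complex.normSq_eq_norm_sq, Complex.normSq_apply, Complex.add_re, Complex.add_im,
        Complex.mul_re, Complex.mul_im, Complex.conj_re, Complex.conj_im]
      ring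
  have t1 : Tendsto (fun N => ∫ ω, Complex.exp (((∑ n ∈ Finset.range N,
      a n ω * (ξ * d n + η * e n)).re : ℂ) * Complex.I) ∂P) atTop
      (𝓝 (∫ ω, Complex.exp (((ξ * X ω + η * Y ω).re : ℂ) * Complex.I) ∂P)) := by
    refine tendsto_integral_of_dominated_convergence (fun _ => 1) (fun N => ?_)
      (integrable_const 1) (fun N => ?_) ?_
    · have : AEMeasurable (fun ω => ∑ n ∈ Finset.range N, a n ω * (ξ * d n + η * e n)) P :=
        Finset.aemeasurable_fun_sum _ fun n _ => (hlaw n).aemeasurable.mul_const _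
      have hc : Measurable fun x : ℂ => Complex.exp ((x.re : ℂ) * Complex.I) := by fun_prop
      exact (hc.comp_aemeasurable this).aestronglyMeasurable
    · filter_upwards with ω
      rw [Complex.norm_exp_ofReal_mul_I]
    · filter_upwards [hX, hY] with ω h1 h2
      have h3 := ((h1.mul_left ξ).add (h2.mul_left η)).tendsto_sum_nat
      have hc : Continuous fun x : ℂ => Complex.exp ((x.re : ℂ) * Complex.I) := by fun_prop
      refine (hc.tendsto _).comp (h3.congr fun N => Finset.sum_congr rfl fun n _ => by ring)
  simp_rw [integral_cexp_sum_range hlaw hindep] at t1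
  refine tendsto_nhds_unique t1 ?_
  have hc : Continuous fun x : ℝ => Complex.exp (-((x / 4 : ℝ) : ℂ)) := by fun_prop
  exact (hc.tendsto _).comp hs.tendsto_sum_nat

end Series

/-! ### Jensen's formula and the zero count -/

/-- Both sides send infinite order to 0, so no assumption excluding locally vanishing functions is
needed. -/
theorem divisor_eq_analyticOrderNatAt {f : ℂ → ℂ} {U : Set ℂ} (hf : AnalyticOnNhd ℂ f U) {u : ℂ}
    (hu : u ∈ U) : MeromorphicOn.divisor f U u = analyticOrderNatAt f u := by
  rw [MeromorphicOn.AnalyticOnNhd.divisor_apply hf hu, analyticOrderNatAt]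
  cases h : analyticOrderAt f u <;> simp

theorem finite_zeros_closedBall {f : ℂ → ℂ} {r : ℝ}
    (hf : AnalyticOnNhd ℂ f (Metric.closedBall 0 r)) :
    (Metric.closedBall 0 r ∩ {u | analyticOrderNatAt f u ≠ 0}).Finite := by
  refine ((MeromorphicOn.divisor f (Metric.closedBall 0 r)).finiteSupport
    (isCompact_closedBall 0 r)).subset ?_
  rintro u ⟨hu, hu'⟩
  rw [Function.mem_support, divisor_eq_analyticOrderNatAt hf hu]
  exact_mod_cast hu'

/-- Jensen's formula as a sum over the zeros in a fixed large disc. -/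
theorem circleAverage_log_norm_eq_sum {f : ℂ → ℂ} {r t : ℝ} (ht : 0 < t) (htr : t ≤ r)
    (hf : AnalyticOnNhd ℂ f (Metric.closedBall 0 r)) (hf0 : f 0 ≠ 0) :
    Real.circleAverage (fun z => Real.log ‖f z‖) 0 t =
      ∑ u ∈ (finite_zeros_closedBall hf).toFinset,
        (analyticOrderNatAt f u : ℝ) * max 0 (Real.log t - Real.log ‖u‖) + Real.log ‖f 0‖ := by
  have hft : AnalyticOnNhd ℂ f (Metric.closedBall 0 |t|) := by
    rw [abs_of_pos ht]
    exact hf.mono (Metric.closedBall_subset_closedBall htr)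
  rw [AnalyticOnNhd.circleAverage_log_norm ht.ne' hft hf0]
  congr 1
  have hnorm : ∀ u, analyticOrderNatAt f u ≠ 0 → 0 < ‖u‖ := by
    intro u hu
    rw [norm_pos_iff]
    rintro rfl
    have h0 := (hf 0 (Metric.mem_closedBall_self (ht.le.trans htr))).analyticOrderAt_eq_zero.2 hf0
    simp [analyticOrderNatAt, h0] at hu
  rw [finsum_eq_sum_of_support_subset (s := (finite_zeros_closedBall hf).toFinset)]
  · refine Finset.sum_congr rfl fun u hu => ?_
    rw [Set.Finite.mem_toFinset] at hu
    have hu0 := hnorm u hu.2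
    by_cases hut : u ∈ Metric.closedBall (0 : ℂ) |t|
    · rw [divisor_eq_analyticOrderNatAt hft hut, zero_sub, norm_neg, ← div_eq_mul_inv,
        Real.log_div ht.ne' hu0.ne', max_eq_right]
      · simp
      · rw [mem_closedBall_zero_iff, abs_of_pos ht] at hut
        exact sub_nonneg.2 (Real.log_le_log hu0 hut)
    · rw [Function.locallyFinsuppWithin.apply_eq_zero_of_notMem _ hut]
      rw [mem_closedBall_zero_iff, abs_of_pos ht, not_le] at hut
      rw [max_eq_left (sub_nonpos.2 (Real.log_le_log ht hut.le))]
      simp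
  · intro u hu
    rw [Function.mem_support] at hu
    have hd : MeromorphicOn.divisor f (Metric.closedBall 0 |t|) u ≠ 0 := by
      rintro h; simp [h] at hu
    have hut : u ∈ Metric.closedBall (0 : ℂ) |t| := by
      by_contra h
      exact hd (Function.locallyFinsuppWithin.apply_eq_zero_of_notMem _ h)
    rw [divisor_eq_analyticOrderNatAt hft hut] at hd
    rw [abs_of_pos ht] at hut
    rw [Finset.mem_coe, Set.Finite.mem_toFinset]
    exact ⟨Metric.closedBall_subset_closedBall htr hut, by exact_mod_cast hd⟩

theorem zeroCount_eq_sum {f : ℂ → ℂ} {r : ℝ} (hf : AnalyticOnNhd ℂ f (Metric.closedBall 0 r)) :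
    (zeroCount f (Metric.ball 0 r) : ℝ) = ∑ u ∈ (finite_zeros_closedBall hf).toFinset,
      if ‖u‖ < r then (analyticOrderNatAt f u : ℝ) else 0 := by
  rw [zeroCount, finsum_mem_eq_sum_of_inter_support_eq
    (t := (finite_zeros_closedBall hf).toFinset.filter fun u => ‖u‖ < r),
    Finset.sum_filter]
  · push_cast
    rfl
  · ext u
    simp only [Set.mem_inter_iff, mem_ball_zero_iff, Function.mem_support, Finset.coe_filter,
      Set.Finite.mem_toFinset, mem_closedBall_zero_iff, Set.mem_ofPred_eq]
    constructor
    · rintro ⟨h1, h2⟩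
      exact ⟨⟨⟨h1.le, h2⟩, h1⟩, h2⟩
    · rintro ⟨⟨_, h1⟩, h2⟩
      exact ⟨h1, h2⟩

/-- The increment of the circular means of `log ‖f‖`, normalized by the increment of `log`. -/
noncomputable def logMeanSlope (f : ℂ → ℂ) (r s : ℝ) : ℝ :=
  (Real.circleAverage (fun z => Real.log ‖f z‖) 0 r -
    Real.circleAverage (fun z => Real.log ‖f z‖) 0 s) / (Real.log r - Real.log s)

theorem logMeanSlope_eq_sum {f : ℂ → ℂ} {r s : ℝ} (hs : 0 < s) (hsr : s < r)
    (hf : AnalyticOnNhd ℂ f (Metric.closedBall 0 r)) (hf0 : f 0 ≠ 0) :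
    logMeanSlope f r s = ∑ u ∈ (finite_zeros_closedBall hf).toFinset, (analyticOrderNatAt f u : ℝ) *
      ((max 0 (Real.log r - Real.log ‖u‖) - max 0 (Real.log s - Real.log ‖u‖)) /
        (Real.log r - Real.log s)) := by
  rw [logMeanSlope, circleAverage_log_norm_eq_sum (hs.trans hsr) le_rfl hf hf0,
    circleAverage_log_norm_eq_sum hs hsr.le hf hf0, add_sub_add_right_eq_sub,
    ← Finset.sum_sub_distrib, Finset.sum_div]
  refine Finset.sum_congr rfl fun u _ => by ring

/-- Each zero contributes its multiplicity times a fraction in [0, 1], since τ ↦ max(0, τ - log ‖u‖)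
is nondecreasing and 1-Lipschitz. Zeros on the circle ‖u‖ = r contribute 0, in agreement with the
open disc. -/
theorem logMeanSlope_mem_Icc {f : ℂ → ℂ} {r s : ℝ} (hs : 0 < s) (hsr : s < r)
    (hf : AnalyticOnNhd ℂ f (Metric.closedBall 0 r)) (hf0 : f 0 ≠ 0) :
    logMeanSlope f r s ∈ Icc 0 (zeroCount f (Metric.ball 0 r) : ℝ) := by
  have hlog : 0 < Real.log r - Real.log s := sub_pos.2 (Real.log_lt_log hs hsr)
  rw [logMeanSlope_eq_sum hs hsr hf hf0, zeroCount_eq_sum hf]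
  constructor
  · refine Finset.sum_nonneg fun u _ => mul_nonneg (Nat.cast_nonneg _) (div_nonneg ?_ hlog.le)
    exact sub_nonneg.2 (max_le_max le_rfl (by linarith))
  · refine Finset.sum_le_sum fun u hu => ?_
    rw [Set.Finite.mem_toFinset, Set.mem_inter_iff, mem_closedBall_zero_iff] at hu
    split_ifs with h
    · refine mul_le_of_le_one_right (Nat.cast_nonneg _) ((div_le_one hlog).2 ?_)
      rcases max_cases (0 : ℝ) (Real.log r - Real.log ‖u‖) with h1 | h1 <;>
      rcases max_cases (0 : ℝ) (Real.log s - Real.log ‖u‖) with h2 | h2 <;> linarith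
    · have : ‖u‖ = r := le_antisymm hu.1 (not_lt.1 h)
      rw [this, sub_self, max_eq_left (by linarith : Real.log s - Real.log r ≤ 0)]
      simp

/-- There are finitely many zeros, so for s close to r none of them lies in s ≤ ‖u‖ < r, and every
zero in the open disc contributes its full multiplicity. -/
theorem eventually_logMeanSlope_eq {f : ℂ → ℂ} {r : ℝ} (hr : 0 < r)
    (hf : AnalyticOnNhd ℂ f (Metric.closedBall 0 r)) (hf0 : f 0 ≠ 0) :
    ∀ᶠ s in 𝓝[<] r, logMeanSlope f r s = (zeroCount f (Metric.ball 0 r) : ℝ) := by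
  have h1 : ∀ᶠ s in 𝓝[<] r, ∀ u ∈ (finite_zeros_closedBall hf).toFinset, ‖u‖ < r → ‖u‖ < s := by
    rw [Filter.eventually_all_finset]
    intro u _
    by_cases h : ‖u‖ < r
    · filter_upwards [Ioo_mem_nhdsLT h] with s hs _ using hs.1
    · filter_upwards with s h' using absurd h' h
  filter_upwards [h1, Ioo_mem_nhdsLT hr] with s h1 hs
  have hlog : 0 < Real.log r - Real.log s := sub_pos.2 (Real.log_lt_log hs.1 hs.2)
  rw [logMeanSlope_eq_sum hs.1 hs.2 hf hf0, zeroCount_eq_sum hf]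
  refine Finset.sum_congr rfl fun u hu => ?_
  have hu' := hu
  rw [Set.Finite.mem_toFinset, Set.mem_inter_iff, mem_closedBall_zero_iff] at hu
  split_ifs with h
  · have h2 := h1 u hu' h
    rcases eq_or_lt_of_le (norm_nonneg u) with h0 | h0
    · have hu0 : u = 0 := norm_eq_zero.1 h0.symm
      have := (hf 0 (Metric.mem_closedBall_self hr.le)).analyticOrderAt_eq_zero.2 hf0
      simp [hu0, analyticOrderNatAt, this]
    · have h3 := Real.log_lt_log h0 h2
      rw [max_eq_right (by linarith), max_eq_right (by linarith), sub_sub_sub_cancel_right,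
        div_self hlog.ne', mul_one]
  · have : ‖u‖ = r := le_antisymm hu.1 (not_lt.1 h)
    rw [this, sub_self, max_eq_left (by linarith : Real.log s - Real.log r ≤ 0)]
    simp

/-! ### Circular means and Parseval's identity -/

/-- The uniform probability measure on the angles `(0, 2π]`. -/
noncomputable def angleMeasure : Measure ℝ :=
  (ENNReal.ofReal (2 * Real.pi))⁻¹ • volume.restrict (Ioc 0 (2 * Real.pi))

instance isProbabilityMeasure_angleMeasure : IsProbabilityMeasure angleMeasure := by
  refine ⟨?_⟩
  rw [angleMeasure, Measure.smul_apply, Measure.restrict_apply_univ, Real.volume_Ioc, sub_zero,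
    smul_eq_mul]
  exact ENNReal.inv_mul_cancel (by simp [Real.pi_pos]) ENNReal.ofReal_ne_top

theorem integral_angleMeasure {E : Type*} [NormedAddCommGroup E] [NormedSpace ℝ E] (f : ℝ → E) :
    ∫ θ, f θ ∂angleMeasure = (2 * Real.pi)⁻¹ • ∫ θ in (0 : ℝ)..2 * Real.pi, f θ := by
  rw [angleMeasure, integral_smul_measure, intervalIntegral.integral_of_le Real.two_pi_pos.le,
    ENNReal.toReal_inv, ENNReal.toReal_ofReal Real.two_pi_pos.le]

theorem circleAverage_eq_integral_angleMeasure {E : Type*} [NormedAddCommGroup E]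
    [NormedSpace ℝ E] (f : ℂ → E) (R : ℝ) :
    Real.circleAverage f 0 R = ∫ θ, f (circleMap 0 R θ) ∂angleMeasure := by
  rw [integral_angleMeasure, Real.circleAverage_def]

theorem integral_angleMeasure_monomial (R : ℝ) (j k : ℕ) :
    ∫ θ, circleMap 0 R θ ^ j * conj (circleMap 0 R θ) ^ k ∂angleMeasure =
      if j = k then (R : ℂ) ^ (j + k) else 0 := by
  have h1 : ∀ θ : ℝ, circleMap 0 R θ ^ j * conj (circleMap 0 R θ) ^ k =
      (R : ℂ) ^ (j + k) * Complex.exp (((j : ℂ) - k) * Complex.I * θ) := by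
    intro θ
    rw [circleMap_zero, map_mul, Complex.conj_ofReal, ← Complex.exp_conj, map_mul,
      Complex.conj_ofReal, Complex.conj_I, mul_pow, mul_pow, ← Complex.exp_nat_mul,
      ← Complex.exp_nat_mul, mul_mul_mul_comm, ← pow_add, ← Complex.exp_add]
    congr 2
    ring
  simp_rw [h1]
  rw [integral_const_mul]
  split_ifs with h
  · simp [h]
  · have hne : ((j : ℂ) - k) * Complex.I ≠ 0 :=
      mul_ne_zero (sub_ne_zero.2 (by exact_mod_cast h)) Complex.I_ne_zero
    rw [integral_angleMeasure, integral_exp_mul_complex hne]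
    have : Complex.exp (((j : ℂ) - k) * Complex.I * (2 * Real.pi : ℝ)) = 1 := by
      rw [Complex.exp_eq_one_iff]
      exact ⟨(j : ℤ) - k, by push_cast; ring⟩
    rw [this]
    simp

/-- Parseval's identity for power series on a circle. -/
theorem hasSum_integral_norm_sq_powerSeries {c : ℕ → ℂ} {R : ℝ}
    (hc : Summable fun j => ‖c j‖ * |R| ^ j) {F : ℂ → ℂ}
    (hF : ∀ θ : ℝ, HasSum (fun j => c j * circleMap 0 R θ ^ j) (F (circleMap 0 R θ))) :
    HasSum (fun j => ‖c j‖ ^ 2 * R ^ (2 * j)) (∫ θ, ‖F (circleMap 0 R θ)‖ ^ 2 ∂angleMeasure) := by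
  have hnorm : ∀ θ j, ‖c j * circleMap 0 R θ ^ j‖ = ‖c j‖ * |R| ^ j := fun θ j => by
    rw [norm_mul, norm_pow, norm_circleMap_zero]
  have hcont : ∀ q : ℕ × ℕ, Continuous fun θ : ℝ =>
      (c q.1 * circleMap 0 R θ ^ q.1) * conj (c q.2 * circleMap 0 R θ ^ q.2) := by
    intro q
    fun_prop
  have hn2 : ∀ (q : ℕ × ℕ) θ,
      ‖(c q.1 * circleMap 0 R θ ^ q.1) * conj (c q.2 * circleMap 0 R θ ^ q.2)‖ =
      (‖c q.1‖ * |R| ^ q.1) * (‖c q.2‖ * |R| ^ q.2) := by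
    intro q θ
    rw [norm_mul, RCLike.norm_conj, hnorm, hnorm]
  have hsum2 : Summable fun q : ℕ × ℕ => (‖c q.1‖ * |R| ^ q.1) * (‖c q.2‖ * |R| ^ q.2) :=
    hc.mul_of_nonneg hc (fun _ => by positivity) (fun _ => by positivity)
  have h := hasSum_integral_of_summable_integral_norm (μ := angleMeasure)
    (F := fun (q : ℕ × ℕ) (θ : ℝ) =>
      (c q.1 * circleMap 0 R θ ^ q.1) * conj (c q.2 * circleMap 0 R θ ^ q.2))
    (fun q => Integrable.of_bound (hcont q).aestronglyMeasurable _
      (ae_of_all _ fun θ => (hn2 q θ).le))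
    (by simp_rw [hn2]; simpa using hsum2)
  have hlim : ∀ θ, ∑' q : ℕ × ℕ,
      (c q.1 * circleMap 0 R θ ^ q.1) * conj (c q.2 * circleMap 0 R θ ^ q.2) =
      ((‖F (circleMap 0 R θ)‖ ^ 2 : ℝ) : ℂ) := by
    intro θ
    have h2 : HasSum (fun j => conj (c j * circleMap 0 R θ ^ j)) (conj (F (circleMap 0 R θ))) :=
      Complex.hasSum_conj'.2 (by simpa using hF θ)
    have h3 := (hF θ).mul h2 (Summable.of_norm (by simpa only [hn2 _ θ] using hsum2))
    rw [h3.tsum_eq, Complex.mul_conj, Complex.normSq_eq_norm_sq]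
  have hval : ∀ q : ℕ × ℕ, ∫ θ, (c q.1 * circleMap 0 R θ ^ q.1) *
      conj (c q.2 * circleMap 0 R θ ^ q.2) ∂angleMeasure =
      if q.1 = q.2 then ((‖c q.1‖ ^ 2 * R ^ (2 * q.1) : ℝ) : ℂ) else 0 := by
    intro q
    have : ∀ θ, (c q.1 * circleMap 0 R θ ^ q.1) * conj (c q.2 * circleMap 0 R θ ^ q.2) =
        c q.1 * conj (c q.2) * (circleMap 0 R θ ^ q.1 * conj (circleMap 0 R θ) ^ q.2) := by
      intro θ
      rw [map_mul, map_pow]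
      ring
    simp_rw [this]
    rw [integral_const_mul, integral_angleMeasure_monomial]
    split_ifs with h
    · rw [← h, Complex.mul_conj, Complex.normSq_eq_norm_sq, two_mul]
      push_cast
      rfl
    · simp
  simp_rw [hval, hlim] at h
  rw [integral_complex_ofReal] at h
  -- By orthogonality only the diagonal of the double series survives.
  have hinj : Function.Injective fun j : ℕ => (j, j) := fun i j h => (Prod.ext_iff.1 h).1
  rw [← hinj.hasSum_iff] at h
  · simp only [Function.comp_def, if_true] at h
    exact Complex.hasSum_ofReal.1 h
  · rintro ⟨i, j⟩ hij
    rw [if_neg]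
    rintro (rfl : i = j)
    exact hij ⟨i, rfl⟩

/-! ### Limits of sums of squared slopes -/

theorem hasSum_prod_of_nonneg {f : ℕ × ℕ → ℝ} (hf : ∀ q, 0 ≤ f q) {g : ℕ → ℝ} {V : ℝ}
    (h1 : ∀ k, HasSum (fun j => f (k, j)) (g k)) (h2 : HasSum g V) : HasSum f V := by
  have hs : Summable f := (summable_prod_of_nonneg hf).2
    ⟨fun k => (h1 k).summable, by simpa only [(h1 _).tsum_eq] using h2.summable⟩
  have := hs.hasSum.prod_fiberwise h1
  rw [h2.unique this]
  exact hs.hasSum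

/-- If `∑ (w i)'²` converges to a continuous function `V`, then the squared increments of the
family `w`, normalized by the squared increment of the variable, sum up to `V` in the limit. -/
theorem tendsto_sum_sq_slope {ι : Type*} {w w' : ι → ℝ → ℝ} {V Q : ℝ → ℝ} {τ₀ : ℝ}
    (hw : ∀ i t, HasDerivAt (w i) (w' i t) t)
    (hw' : ∀ᶠ t in 𝓝 τ₀, HasSum (fun i => w' i t ^ 2) (V t)) (hV : ContinuousAt V τ₀)
    (hQ : ∀ᶠ t in 𝓝[<] τ₀, HasSum (fun i => (w i τ₀ - w i t) ^ 2) (Q t)) :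
    Tendsto (fun t => Q t / (τ₀ - t) ^ 2) (𝓝[<] τ₀) (𝓝 (V τ₀)) := by
  have hV0 : 0 ≤ V τ₀ := hw'.self_of_nhds.nonneg fun i => sq_nonneg _
  refine tendsto_order.2 ⟨fun b hb => ?_, fun b hb => ?_⟩
  -- Lower bound: a finite partial sum already exceeds b at τ₀, and finitely many slopes converge to
  -- their derivatives.
  · obtain ⟨S, hS⟩ := ((hw'.self_of_nhds).eventually (lt_mem_nhds hb)).exists
    have hlim : Tendsto (fun t => ∑ i ∈ S, ((w i τ₀ - w i t) / (τ₀ - t)) ^ 2) (𝓝[<] τ₀)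
        (𝓝 (∑ i ∈ S, w' i τ₀ ^ 2)) := by
      refine tendsto_finsetSum _ fun i _ => Tendsto.pow ?_ 2
      have := (hasDerivAt_iff_tendsto_slope.1 (hw i τ₀)).mono_left
        (nhdsWithin_mono τ₀ (fun t (ht : t < τ₀) => ht.ne))
      refine this.congr fun t => ?_
      rw [slope_def_field, ← neg_sub (w i τ₀), ← neg_sub τ₀, neg_div_neg_eq]
    filter_upwards [hlim.eventually (lt_mem_nhds hS), hQ, self_mem_nhdsWithin] with t h1 h2 ht
    refine h1.trans_le ?_
    simp_rw [div_pow]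
    rw [← Finset.sum_div]
    gcongr
    exact sum_le_hasSum S (fun i _ => sq_nonneg _) h2
  -- Upper bound: by continuity the sum of squared derivatives stays below b' near τ₀. The mean
  -- value inequality for the finite-dimensional curve (w i)_{i ∈ S} then bounds every partial sum
  -- of squared increments by b'(τ₀ - t)², uniformly in S.
  · obtain ⟨b', hb', hbb'⟩ := exists_between hb
    have hb'0 : 0 ≤ b' := hV0.trans hb'.le
    obtain ⟨ε, hε, hball⟩ := Metric.eventually_nhds_iff.1
      (hw'.and (hV.eventually (gt_mem_nhds hb')))
    have hIoo : Ioo (τ₀ - ε) τ₀ ∈ 𝓝[<] τ₀ := Ioo_mem_nhdsLT (by linarith)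
    filter_upwards [hQ, hIoo] with t h2 ht
    have hpos : 0 < τ₀ - t := sub_pos.2 ht.2
    refine lt_of_le_of_lt ?_ hbb'
    rw [div_le_iff₀ (by positivity)]
    refine hasSum_le_of_sum_le h2 fun S => ?_
    let W : ℝ → EuclideanSpace ℝ S := fun t => WithLp.toLp 2 fun i => w i t
    let W' : ℝ → EuclideanSpace ℝ S := fun t => WithLp.toLp 2 fun i => w' i t
    have hWd : ∀ t, HasDerivAt W (W' t) t := fun t =>
      (PiLp.hasFDerivAt_toLp (𝕜 := ℝ) 2 (fun i : S => w i t)).comp_hasDerivAt t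
        (hasDerivAt_pi.2 fun i : S => hw i t)
    have hnorm : ∀ x ∈ Icc t τ₀, ‖W' x‖ ≤ Real.sqrt b' := by
      intro x hx
      rw [EuclideanSpace.norm_eq]
      refine Real.sqrt_le_sqrt ?_
      have hx' := hball (y := x) (by
        rw [Real.dist_eq, abs_lt]; constructor <;> linarith [hx.1, hx.2, ht.1])
      have := sum_le_hasSum S (fun i _ => sq_nonneg _) hx'.1
      rw [← Finset.sum_coe_sort] at this
      simp only [W', Real.norm_eq_abs, sq_abs]
      exact this.trans hx'.2.le
    have hmv := Convex.norm_image_sub_le_of_norm_hasDerivWithin_le (s := Icc t τ₀) (f := W)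
      (f' := W') (fun x _ => (hWd x).hasDerivWithinAt) hnorm (convex_Icc t τ₀)
      (left_mem_Icc.2 ht.2.le) (right_mem_Icc.2 ht.2.le)
    have h3 := pow_le_pow_left₀ (norm_nonneg _) hmv 2
    rw [mul_pow, Real.sq_sqrt hb'0, Real.norm_eq_abs, sq_abs, EuclideanSpace.norm_eq,
      Real.sq_sqrt (Finset.sum_nonneg fun _ _ => sq_nonneg _)] at h3
    simp only [W, Real.norm_eq_abs, sq_abs, PiLp.sub_apply] at h3
    rwa [← Finset.sum_coe_sort]

/-! ### Chaos coordinates and the sum of their squared derivatives -/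

theorem summable_norm_choose_mul_pow (p : ℕ) {x : ℝ} (hx0 : 0 ≤ x) (hx1 : x < 1) :
    Summable fun j : ℕ => ((j + p).choose p : ℝ) * x ^ j :=
  (hasSum_choose_mul_geometric_of_norm_lt_one p (by rwa [Real.norm_of_nonneg hx0])).summable

theorem natCast_add_mul_choose (p j : ℕ) (R : Type*) [CommRing R] :
    ((j : R) + p + 1) * ((j + p).choose p : R) = (p + 1) * ((j + (p + 1)).choose (p + 1) : R) := by
  have h := congrArg (Nat.cast : ℕ → R) (Nat.add_one_mul_choose_eq (j + p) p)
  push_cast at h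
  rw [mul_comm ((p : R) + 1), ← add_assoc, h]

/-- Coefficients linear in j become a combination of two binomials, so their generating function is
a combination of (1 - z)^{-(p+2)} and (1 - z)^{-(p+1)}. -/
theorem natCast_sub_mul_choose (p j : ℕ) (R : Type*) [CommRing R] (x : R) :
    ((j : R) - (j + p + 1) * x) * ((j + p).choose p : R) =
      (p + 1) * ((1 - x) * ((j + (p + 1)).choose (p + 1) : R) - ((j + p).choose p : R)) := by
  have h := natCast_add_mul_choose p j R
  linear_combination (1 - x) * h

theorem hasSum_natCast_sub_mul_choose (p : ℕ) (x : ℂ) {z : ℂ} (hz : ‖z‖ < 1) :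
    HasSum (fun j : ℕ => ((j : ℂ) - (j + p + 1) * x) * ((j + p).choose p : ℂ) * z ^ j)
      ((p + 1) * (z - x) / (1 - z) ^ (p + 2)) := by
  have h1 := hasSum_choose_mul_geometric_of_norm_lt_one (p + 1) hz
  have h2 := hasSum_choose_mul_geometric_of_norm_lt_one p hz
  have hz1 : 1 - z ≠ 0 := sub_ne_zero.2 (by rintro rfl; simp at hz)
  convert! ((h1.mul_left (1 - x)).sub h2).mul_left ((p : ℂ) + 1) using 1
  · ext j
    rw [natCast_sub_mul_choose]
    ring
  · field_simp
    ring

theorem norm_one_sub_circleMap_sq (x θ : ℝ) :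
    ‖1 - circleMap 0 x θ‖ ^ 2 = 1 + x ^ 2 - 2 * x * Real.cos θ := by
  rw [circleMap_zero, ← Complex.normSq_eq_norm_sq, Complex.normSq_apply]
  simp only [Complex.sub_re, Complex.sub_im, Complex.mul_re, Complex.mul_im, Complex.ofReal_re,
    Complex.ofReal_im, Complex.exp_ofReal_mul_I_re, Complex.exp_ofReal_mul_I_im, Complex.one_re,
    Complex.one_im]
  linear_combination x ^ 2 * Real.sin_sq_add_cos_sq θ

theorem norm_circleMap_sub_sq (x θ : ℝ) :
    ‖circleMap 0 x θ - x‖ ^ 2 = x * (‖1 - circleMap 0 x θ‖ ^ 2 - (1 - x) ^ 2) := by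
  rw [norm_one_sub_circleMap_sq, circleMap_zero, ← Complex.normSq_eq_norm_sq, Complex.normSq_apply]
  simp only [Complex.sub_re, Complex.sub_im, Complex.mul_re, Complex.mul_im, Complex.ofReal_re,
    Complex.ofReal_im, Complex.exp_ofReal_mul_I_re, Complex.exp_ofReal_mul_I_im]
  linear_combination x ^ 2 * Real.sin_sq_add_cos_sq θ

theorem one_sub_sq_le_norm_sq {x : ℝ} (hx0 : 0 ≤ x) (θ : ℝ) :
    (1 - x) ^ 2 ≤ ‖1 - circleMap 0 x θ‖ ^ 2 := by
  rw [norm_one_sub_circleMap_sq]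
  nlinarith [Real.cos_le_one θ]

/-- Equality forces cos θ = 1. Those angles must be discarded because the geometric series over κ
has ratio 1 there. -/
theorem ae_one_sub_sq_lt_norm_sq {x : ℝ} (hx0 : 0 < x) :
    ∀ᵐ θ ∂angleMeasure, (1 - x) ^ 2 < ‖1 - circleMap 0 x θ‖ ^ 2 := by
  have h1 : ∀ᵐ θ ∂volume.restrict (Ioc 0 (2 * Real.pi)), θ ≠ 2 * Real.pi :=
    ae_restrict_of_ae (Measure.ae_ne _ _)
  have h2 : ∀ᵐ θ ∂volume.restrict (Ioc 0 (2 * Real.pi)),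
      (1 - x) ^ 2 < ‖1 - circleMap 0 x θ‖ ^ 2 := by
    filter_upwards [h1, ae_restrict_mem measurableSet_Ioc] with θ h1 h2
    have hc : Real.cos θ < 1 := by
      refine lt_of_le_of_ne (Real.cos_le_one θ) fun h => h2.1.ne' ?_
      exact (Real.cos_eq_one_iff_of_lt_of_lt (by linarith [h2.1, Real.pi_pos])
        (lt_of_le_of_ne h2.2 h1)).1 h
    rw [norm_one_sub_circleMap_sq]
    nlinarith
  exact Measure.ae_smul_measure h2 _

/-- The degree of the kernel `|1 - z w̄|^{-2 (ℓ + 1) (κ + 1)}`, shifted by one. -/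
def chaosDegree (ℓ κ : ℕ) : ℕ := ℓ + (ℓ + 1) * κ

theorem chaosDegree_add_one (ℓ κ : ℕ) : chaosDegree ℓ κ + 1 = (ℓ + 1) * (κ + 1) := by
  unfold chaosDegree; ring

/-- The coordinates of the circular mean of `log |f|`, as functions of the logarithm of the
radius. -/
noncomputable def chaosCoord (ℓ : ℕ) (q : ℕ × ℕ) (τ : ℝ) : ℝ :=
  ((q.2 + chaosDegree ℓ q.1).choose (chaosDegree ℓ q.1) : ℝ) / (2 * (q.1 + 1)) *
    ((1 - Real.exp (2 * τ)) ^ (chaosDegree ℓ q.1 + 1) * Real.exp (2 * τ) ^ q.2)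

/-- The derivatives of the coordinates `chaosCoord`. -/
noncomputable def chaosCoordDeriv (ℓ : ℕ) (q : ℕ × ℕ) (τ : ℝ) : ℝ :=
  ((q.2 + chaosDegree ℓ q.1).choose (chaosDegree ℓ q.1) : ℝ) / (q.1 + 1) *
    ((1 - Real.exp (2 * τ)) ^ chaosDegree ℓ q.1 * Real.exp (2 * τ) ^ q.2 *
      (q.2 - (q.2 + chaosDegree ℓ q.1 + 1) * Real.exp (2 * τ)))

theorem hasDerivAt_chaosCoord (ℓ : ℕ) (q : ℕ × ℕ) (τ : ℝ) :
    HasDerivAt (chaosCoord ℓ q) (chaosCoordDeriv ℓ q τ) τ := by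
  have he : HasDerivAt (fun τ => Real.exp (2 * τ)) (2 * Real.exp (2 * τ)) τ := by
    convert! ((hasDerivAt_id τ).const_mul 2).exp using 1
    simp only [id]
    ring
  have h := (((he.const_sub 1).pow (chaosDegree ℓ q.1 + 1)).mul (he.pow q.2)).const_mul
    (((q.2 + chaosDegree ℓ q.1).choose (chaosDegree ℓ q.1) : ℝ) / (2 * (q.1 + 1)))
  refine h.congr_deriv ?_
  unfold chaosCoordDeriv
  simp only [Pi.pow_apply]
  generalize chaosDegree ℓ q.1 = p
  generalize Real.exp (2 * τ) = x
  have h1 : (q.1 : ℝ) + 1 ≠ 0 := by positivity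
  simp only [Nat.add_sub_cancel, Nat.cast_add, Nat.cast_one]
  rcases q with ⟨k, j⟩
  cases j with
  | zero => simp; field_simp
  | succ j =>
    simp only [Nat.add_sub_cancel, Nat.cast_add, Nat.cast_one, pow_succ]
    field_simp
    ring

/-- The density, as a function of `D = |1 - x e^{iθ}|²`, of the contribution of one chaos to the
variance of the number of zeros. -/
noncomputable def chaosDensity (ℓ : ℕ) (x D : ℝ) (κ : ℕ) : ℝ :=
  (ℓ + 1) ^ 2 * (x * (D - (1 - x) ^ 2) / ((1 - x) ^ 2 * D)) *
    (((1 - x) ^ 2 / D) ^ (ℓ + 1)) ^ (κ + 1)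

/-- Parseval's identity on the circle of radius x = e^{2τ} (the squared radius of the disc) for (p +
1)(z - x) / (1 - z)^{p+2}, where p + 1 = (ℓ + 1)(κ + 1). The numerator is expressed through D by |z
- x|² = x(D - (1 - x)²). -/
theorem hasSum_chaosCoordDeriv_sq (ℓ κ : ℕ) {τ : ℝ} (hτ : τ < 0) :
    HasSum (fun j => chaosCoordDeriv ℓ (κ, j) τ ^ 2)
      (∫ θ, chaosDensity ℓ (Real.exp (2 * τ)) (‖1 - circleMap 0 (Real.exp (2 * τ)) θ‖ ^ 2) κ
        ∂angleMeasure) := by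
  unfold chaosCoordDeriv
  have hx1 : Real.exp (2 * τ) < 1 := Real.exp_lt_one_iff.2 (by linarith)
  have hx0 := Real.exp_pos (2 * τ)
  generalize Real.exp (2 * τ) = x at hx0 hx1
  have hp := chaosDegree_add_one ℓ κ
  simp only
  set p := chaosDegree ℓ κ with hpdef
  have hF : ∀ θ : ℝ, HasSum (fun j : ℕ => (((j : ℂ) - (j + p + 1) * x) * ((j + p).choose p : ℂ)) *
      circleMap 0 x θ ^ j) ((fun z : ℂ => ((p : ℂ) + 1) * (z - x) / (1 - z) ^ (p + 2))
        (circleMap 0 x θ)) := fun θ =>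
    hasSum_natCast_sub_mul_choose p x (by rwa [norm_circleMap_zero, abs_of_pos hx0])
  have hnorm : ∀ j : ℕ, ‖((j : ℂ) - (j + p + 1) * x) * ((j + p).choose p : ℂ)‖ =
      |((j : ℝ) - (j + p + 1) * x) * ((j + p).choose p : ℝ)| := fun j => by
    rw [← Real.norm_eq_abs, ← Complex.norm_real]
    push_cast
    rfl
  have hs : Summable fun j : ℕ => ‖((j : ℂ) - (j + p + 1) * x) * ((j + p).choose p : ℂ)‖ *
      |x| ^ j := by
    simp_rw [hnorm, natCast_sub_mul_choose]
    refine Summable.of_nonneg_of_le (fun j => by positivity) (fun j => ?_)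
      (((summable_norm_choose_mul_pow (p + 1) hx0.le hx1).add
        (summable_norm_choose_mul_pow p hx0.le hx1)).mul_left ((p : ℝ) + 1))
    rw [abs_of_pos hx0, abs_mul, abs_of_nonneg (by positivity : (0 : ℝ) ≤ p + 1), mul_assoc,
      ← add_mul]
    have h1 := abs_sub ((1 - x) * ((j + (p + 1)).choose (p + 1) : ℝ)) ((j + p).choose p : ℝ)
    rw [abs_mul, abs_of_pos (sub_pos.2 hx1), Nat.abs_cast, Nat.abs_cast] at h1
    have h2 : (1 - x) * ((j + (p + 1)).choose (p + 1) : ℝ) ≤ ((j + (p + 1)).choose (p + 1) : ℝ) :=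
      mul_le_of_le_one_left (Nat.cast_nonneg _) (by linarith)
    gcongr
    linarith
  have h := (hasSum_integral_norm_sq_powerSeries
    (F := fun z : ℂ => ((p : ℂ) + 1) * (z - x) / (1 - z) ^ (p + 2)) hs hF).mul_left ((1 - x) ^ (2 * p) / (κ + 1) ^ 2)
  rw [← integral_const_mul] at h
  convert! h using 1
  · ext j
    rw [hnorm, sq_abs]
    have hk : (κ : ℝ) + 1 ≠ 0 := by positivity
    field_simp
    ring
  · congr 1 with θ
    unfold chaosDensity
    have hD := (by nlinarith : 0 < (1 - x) ^ 2).trans_le (one_sub_sq_le_norm_sq hx0.le θ)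
    have hk : (κ : ℝ) + 1 ≠ 0 := by positivity
    have hx' : 1 - x ≠ 0 := (sub_pos.2 hx1).ne'
    have hpr : (p : ℝ) + 1 = (ℓ + 1) * (κ + 1) := by exact_mod_cast hp
    have hpn : ‖(p : ℂ) + 1‖ = (ℓ + 1) * (κ + 1) := by
      rw [← hpr, ← Complex.norm_of_nonneg (by positivity : (0 : ℝ) ≤ p + 1)]
      push_cast
      rfl
    have hR : ∀ N M : ℝ, (((ℓ : ℝ) + 1) * (κ + 1) * N / M ^ (p + 2)) ^ 2 =
        (ℓ + 1) ^ 2 * (κ + 1) ^ 2 * N ^ 2 / (M ^ 2) ^ (p + 2) := fun N M => by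
      rw [div_pow, mul_pow, mul_pow, ← pow_mul, ← pow_mul, mul_comm (p + 2)]
    rw [norm_div, norm_mul, hpn, norm_pow, hR, norm_circleMap_sub_sq, ← pow_mul _ (ℓ + 1), ← hp,
      pow_mul (1 - x) 2 p]
    generalize ‖1 - circleMap 0 x θ‖ ^ 2 = D at hD
    have hA : (1 - x) ^ 2 ≠ 0 := pow_ne_zero 2 hx'
    generalize (1 - x) ^ 2 = A at hA
    rw [div_pow, pow_succ D (p + 1), pow_succ A p]
    field_simp

theorem hasSum_chaosDensity {ℓ : ℕ} {x D : ℝ} (hx1 : x < 1) (hD : (1 - x) ^ 2 < D) :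
    HasSum (chaosDensity ℓ x D) ((ℓ + 1) ^ 2 * (x * (D - (1 - x) ^ 2) / ((1 - x) ^ 2 * D)) *
      ((1 - x) ^ 2) ^ (ℓ + 1) / (D ^ (ℓ + 1) - ((1 - x) ^ 2) ^ (ℓ + 1))) := by
  have hA : 0 < (1 - x) ^ 2 := by nlinarith
  unfold chaosDensity
  generalize (1 - x) ^ 2 = A at *
  have hD0 := hA.trans hD
  have hq0 : 0 ≤ (A / D) ^ (ℓ + 1) := by positivity
  have hq1 : (A / D) ^ (ℓ + 1) < 1 := pow_lt_one₀ (by positivity) ((div_lt_one hD0).2 hD) (by simp)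
  have h := (hasSum_geometric_of_lt_one hq0 hq1).mul_left
    ((ℓ + 1) ^ 2 * (x * (D - A) / (A * D)) * (A / D) ^ (ℓ + 1))
  have hlt : A ^ (ℓ + 1) < D ^ (ℓ + 1) := pow_lt_pow_left₀ hD hA.le (by simp)
  convert! h using 1
  · ext k
    rw [pow_succ]
    ring
  · rw [mul_div_assoc, mul_assoc _ ((A / D) ^ (ℓ + 1))]
    congr 1
    have h1 : D ^ (ℓ + 1) - A ^ (ℓ + 1) ≠ 0 := (sub_pos.2 hlt).ne'
    rw [div_pow, one_sub_div (by positivity), inv_div]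
    field_simp

/-- The variance of the number of zeros as a circular mean. -/
theorem hasSum_chaosCoordDeriv_sq_of_density {ℓ : ℕ} {τ : ℝ} (hτ : τ < 0) {G : ℝ → ℝ}
    (hG : ∀ D, (1 - Real.exp (2 * τ)) ^ 2 < D → HasSum (chaosDensity ℓ (Real.exp (2 * τ)) D) (G D))
    (hGint : Integrable (fun θ => G (‖1 - circleMap 0 (Real.exp (2 * τ)) θ‖ ^ 2)) angleMeasure) :
    HasSum (fun q => chaosCoordDeriv ℓ q τ ^ 2)
      (∫ θ, G (‖1 - circleMap 0 (Real.exp (2 * τ)) θ‖ ^ 2) ∂angleMeasure) := by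
  refine hasSum_prod_of_nonneg (fun q => sq_nonneg _)
    (fun κ => hasSum_chaosCoordDeriv_sq ℓ κ hτ) ?_
  have hx1 : Real.exp (2 * τ) < 1 := Real.exp_lt_one_iff.2 (by linarith)
  have hx0 := Real.exp_pos (2 * τ)
  generalize Real.exp (2 * τ) = x at *
  have hae := ae_one_sub_sq_lt_norm_sq hx0
  have hA : 0 < (1 - x) ^ 2 := by nlinarith
  -- The terms are nonnegative almost everywhere and so serve as their own bounds; their sum is the
  -- integrable function of `hGint`.
  refine hasSum_integral_of_dominated_convergence (fun κ θ =>
    chaosDensity ℓ x (‖1 - circleMap 0 x θ‖ ^ 2) κ) (fun κ => ?_) (fun κ => ?_) ?_ ?_ ?_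
  · unfold chaosDensity
    exact (Measurable.aestronglyMeasurable (by fun_prop))
  · filter_upwards [hae] with θ hθ
    refine le_of_eq (Real.norm_of_nonneg ?_)
    unfold chaosDensity
    have := sub_pos.2 hθ
    positivity
  · filter_upwards [hae] with θ hθ using (hG _ hθ).summable
  · refine hGint.congr ?_
    filter_upwards [hae] with θ hθ using (hG _ hθ).tsum_eq.symm
  · filter_upwards [hae] with θ hθ using hG _ hθ

theorem integral_inv_norm_one_sub_circleMap_sq {x : ℝ} (hx0 : 0 ≤ x) (hx1 : x < 1) :
    ∫ θ, (‖1 - circleMap 0 x θ‖ ^ 2)⁻¹ ∂angleMeasure = (1 - x ^ 2)⁻¹ := by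
  have hz : ∀ θ, ‖circleMap 0 x θ‖ < 1 := fun θ => by
    rwa [norm_circleMap_zero, abs_of_nonneg hx0]
  have h := hasSum_integral_norm_sq_powerSeries (c := fun _ => 1) (R := x) (F := fun z => (1 - z)⁻¹)
    (by simpa using summable_geometric_of_lt_one (abs_nonneg x) (by rwa [abs_of_nonneg hx0]))
    (fun θ => by simpa using hasSum_geometric_of_norm_lt_one (hz θ))
  have h2 : HasSum (fun j => (x ^ 2) ^ j) (1 - x ^ 2)⁻¹ :=
    hasSum_geometric_of_lt_one (sq_nonneg x) (by nlinarith)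
  simp only [norm_one, one_pow, one_mul, pow_mul, norm_inv, inv_pow] at h
  exact h.unique h2

theorem integrable_inv_norm_one_sub_circleMap_sq_add {x a : ℝ} (hx0 : 0 ≤ x) (hx1 : x < 1)
    (ha : 0 ≤ a) : Integrable (fun θ => (‖1 - circleMap 0 x θ‖ ^ 2 + a)⁻¹) angleMeasure := by
  refine Integrable.of_bound (Measurable.aestronglyMeasurable (by fun_prop)) ((1 - x) ^ 2)⁻¹
    (ae_of_all _ fun θ => ?_)
  have hA : 0 < (1 - x) ^ 2 := by nlinarith
  have := one_sub_sq_le_norm_sq hx0 θ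
  rw [Real.norm_of_nonneg (by positivity)]
  gcongr
  linarith

/-- The denominator is a - 2x cos θ with a = 2(1 - x + x²). It is a constant multiple of |1 - y
e^{iθ}|² for y = (a - w) / (2x), w = √(a² - 4x²), the root of x y² - a y + x = 0 in (0, 1); this
reduces to the Poisson-type mean with radius y. -/
theorem integral_inv_norm_one_sub_circleMap_sq_add {x : ℝ} (hx0 : 0 < x) (hx1 : x < 1) :
    ∫ θ, (‖1 - circleMap 0 x θ‖ ^ 2 + (1 - x) ^ 2)⁻¹ ∂angleMeasure =
      (2 * (1 - x) * Real.sqrt (1 + x ^ 2))⁻¹ := by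
  set w := 2 * (1 - x) * Real.sqrt (1 + x ^ 2) with hw
  set a := 2 * (1 - x + x ^ 2) with ha
  have hsq := Real.sq_sqrt (by positivity : 0 ≤ 1 + x ^ 2)
  have hspos := Real.sqrt_pos.2 (by positivity : 0 < 1 + x ^ 2)
  have h1x : 0 < 1 - x := by linarith
  have hwpos : 0 < w := by positivity
  have hw2 : w ^ 2 = a ^ 2 - 4 * x ^ 2 := by
    rw [hw, mul_pow, hsq, ha]; ring
  have hapos : 0 < a := by rw [ha]; nlinarith
  have hwa : w < a := by nlinarith
  have ha2 : 2 * x < a := by rw [ha]; nlinarith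
  have hy1 : (a - w) / (2 * x) < 1 := by
    rw [div_lt_one (by positivity)]; nlinarith
  have hy0 : 0 < (a - w) / (2 * x) := div_pos (by linarith) (by positivity)
  have h := integral_inv_norm_one_sub_circleMap_sq hy0.le hy1
  have hrel : ∀ θ, (‖1 - circleMap 0 x θ‖ ^ 2 + (1 - x) ^ 2)⁻¹ =
      ((a + w) / 2)⁻¹ * (‖1 - circleMap 0 ((a - w) / (2 * x)) θ‖ ^ 2)⁻¹ := by
    intro θ
    rw [← mul_inv, norm_one_sub_circleMap_sq, norm_one_sub_circleMap_sq]
    congr 1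
    field_simp
    rw [ha]
    have : w ^ 2 = (2 * (1 - x + x ^ 2)) ^ 2 - 4 * x ^ 2 := hw2
    ring_nf
    ring_nf at this
    rw [show w ^ 3 = w * w ^ 2 by ring, this]
    ring
  simp_rw [hrel]
  rw [integral_const_mul, h, ← mul_inv]
  congr 1
  field_simp
  linear_combination (a - w) * hw2

/-- For ℓ = 0 the factor D - A cancels in the geometric sum, leaving x / D. -/
theorem hasSum_chaosCoordDeriv_sq_one {τ : ℝ} (hτ : τ < 0) :
    HasSum (fun q => chaosCoordDeriv 0 q τ ^ 2)
      (Real.exp (2 * τ) / (1 - Real.exp (2 * τ) ^ 2)) := by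
  have hx1 : Real.exp (2 * τ) < 1 := Real.exp_lt_one_iff.2 (by linarith)
  have hx0 := Real.exp_pos (2 * τ)
  have h := hasSum_chaosCoordDeriv_sq_of_density (ℓ := 0) hτ
    (G := fun D => Real.exp (2 * τ) * D⁻¹) (fun D hD => ?_) ?_
  · rwa [integral_const_mul, integral_inv_norm_one_sub_circleMap_sq hx0.le hx1,
      ← div_eq_mul_inv] at h
  · have h := hasSum_chaosDensity (ℓ := 0) hx1 hD
    have hA : 0 < (1 - Real.exp (2 * τ)) ^ 2 := by nlinarith
    convert! h using 1
    generalize (1 - Real.exp (2 * τ)) ^ 2 = A at *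
    have := (sub_pos.2 hD).ne'
    have := (hA.trans hD).ne'
    simp only [CharP.cast_eq_zero, zero_add, one_pow, pow_one, one_mul]
    field_simp
  · simpa using (integrable_inv_norm_one_sub_circleMap_sq_add hx0.le hx1 le_rfl).const_mul
      (Real.exp (2 * τ))

/-- For ℓ = 1, D² - A² = (D - A)(D + A), leaving 4xA / (D(D + A)) = 4x(1/D - 1/(D + A)). -/
theorem hasSum_chaosCoordDeriv_sq_two {τ : ℝ} (hτ : τ < 0) :
    HasSum (fun q => chaosCoordDeriv 1 q τ ^ 2)
      (4 * Real.exp (2 * τ) / (1 - Real.exp (2 * τ)) *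
        (1 / (1 + Real.exp (2 * τ)) - 1 / (2 * Real.sqrt (1 + Real.exp (2 * τ) ^ 2)))) := by
  have hx1 : Real.exp (2 * τ) < 1 := Real.exp_lt_one_iff.2 (by linarith)
  have hx0 := Real.exp_pos (2 * τ)
  have i1 : Integrable (fun θ => (‖1 - circleMap 0 (Real.exp (2 * τ)) θ‖ ^ 2)⁻¹) angleMeasure := by
    simpa using integrable_inv_norm_one_sub_circleMap_sq_add hx0.le hx1 le_rfl
  have i2 := integrable_inv_norm_one_sub_circleMap_sq_add hx0.le hx1
    (sq_nonneg (1 - Real.exp (2 * τ)))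
  have h := hasSum_chaosCoordDeriv_sq_of_density (ℓ := 1) hτ
    (G := fun D => 4 * Real.exp (2 * τ) * (D⁻¹ - (D + (1 - Real.exp (2 * τ)) ^ 2)⁻¹))
    (fun D hD => ?_) ((i1.sub i2).const_mul _)
  · rw [integral_const_mul, integral_sub i1 i2, integral_inv_norm_one_sub_circleMap_sq hx0.le hx1,
      integral_inv_norm_one_sub_circleMap_sq_add hx0 hx1] at h
    convert! h using 1
    generalize Real.exp (2 * τ) = x at *
    have h1 : 1 - x ≠ 0 := (sub_pos.2 hx1).ne'
    have h2 : 1 - x ^ 2 ≠ 0 := by nlinarith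
    have h3 : Real.sqrt (1 + x ^ 2) ≠ 0 := (Real.sqrt_pos.2 (by positivity)).ne'
    have h4 : 1 + x ≠ 0 := by positivity
    rw [show 1 - x ^ 2 = (1 - x) * (1 + x) by ring]
    field_simp
  · have h := hasSum_chaosDensity (ℓ := 1) hx1 hD
    have hA : 0 < (1 - Real.exp (2 * τ)) ^ 2 := by nlinarith
    convert! h using 1
    generalize (1 - Real.exp (2 * τ)) ^ 2 = A at *
    have h1 := (sub_pos.2 hD).ne'
    have h2 := (hA.trans hD).ne'
    have h3 : D + A ≠ 0 := by linarith [hA.trans hD]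
    rw [show D ^ (1 + 1) - A ^ (1 + 1) = (D - A) * (D + A) by ring]
    push_cast
    field_simp
    ring

/-! ### Expansion of the covariance of circular means -/

/-- The squared modulus of the correlation between the values at `z` and `w` of the hyperbolic
Gaussian analytic function of intensity `ℓ + 1`. -/
noncomputable def corrSq (ℓ : ℕ) (z w : ℂ) : ℝ :=
  ((1 - ‖z‖ ^ 2) * (1 - ‖w‖ ^ 2) / ‖1 - conj z * w‖ ^ 2) ^ (ℓ + 1)

theorem norm_one_sub_conj_mul_sq (z w : ℂ) :
    ‖1 - conj z * w‖ ^ 2 = (1 - ‖z‖ ^ 2) * (1 - ‖w‖ ^ 2) + ‖z - w‖ ^ 2 := by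
  simp only [← Complex.normSq_eq_norm_sq, Complex.normSq_apply, Complex.sub_re, Complex.sub_im,
    Complex.mul_re, Complex.mul_im, Complex.conj_re, Complex.conj_im, Complex.one_re,
    Complex.one_im]
  ring

theorem corrSq_nonneg (ℓ : ℕ) {z w : ℂ} (hz : ‖z‖ < 1) (hw : ‖w‖ < 1) : 0 ≤ corrSq ℓ z w := by
  have h1 : 0 < 1 - ‖z‖ ^ 2 := by nlinarith [norm_nonneg z]
  have h2 : 0 < 1 - ‖w‖ ^ 2 := by nlinarith [norm_nonneg w]
  unfold corrSq
  positivity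

theorem corrSq_le_one (ℓ : ℕ) {z w : ℂ} (hz : ‖z‖ < 1) (hw : ‖w‖ < 1) : corrSq ℓ z w ≤ 1 := by
  have h1 : 0 < 1 - ‖z‖ ^ 2 := by nlinarith [norm_nonneg z]
  have h2 : 0 < 1 - ‖w‖ ^ 2 := by nlinarith [norm_nonneg w]
  refine pow_le_one₀ (by positivity) ?_
  rw [norm_one_sub_conj_mul_sq, div_le_one (by positivity)]
  nlinarith [sq_nonneg ‖z - w‖]

theorem exp_two_mul_log {r : ℝ} (hr : 0 < r) : Real.exp (2 * Real.log r) = r ^ 2 := by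
  rw [two_mul, Real.exp_add, Real.exp_log hr, sq]

/-- Parseval's identity on ‖w‖ = s for the binomial series of (1 - conj z · w)^{-(p+1)}. The
coefficients enter through ‖z‖ = r only, so the mean over φ does not depend on θ. -/
theorem hasSum_integral_corrSq_pow (ℓ κ : ℕ) {r s : ℝ} (hr0 : 0 < r) (hr1 : r < 1) (hs0 : 0 < s)
    (hs1 : s < 1) (θ : ℝ) :
    HasSum (fun j => chaosCoord ℓ (κ, j) (Real.log r) * chaosCoord ℓ (κ, j) (Real.log s))
      (∫ φ, corrSq ℓ (circleMap 0 r θ) (circleMap 0 s φ) ^ (κ + 1) / (4 * (κ + 1 : ℝ) ^ 2)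
        ∂angleMeasure) := by
  unfold chaosCoord
  rw [exp_two_mul_log hr0, exp_two_mul_log hs0]
  have hp := chaosDegree_add_one ℓ κ
  simp only
  generalize chaosDegree ℓ κ = p at hp
  set z := circleMap 0 r θ with hz
  have hzr : ‖z‖ = r := by rw [hz, norm_circleMap_zero, abs_of_pos hr0]
  have hrs : r * s < 1 := by nlinarith
  have hF : ∀ φ : ℝ, HasSum (fun j : ℕ => (((j + p).choose p : ℂ) * conj z ^ j) *
      circleMap 0 s φ ^ j) ((fun w : ℂ => 1 / (1 - conj z * w) ^ (p + 1)) (circleMap 0 s φ)) := by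
    intro φ
    have h := hasSum_choose_mul_geometric_of_norm_lt_one p
      (r := conj z * circleMap 0 s φ) (by
        rwa [norm_mul, RCLike.norm_conj, hzr, norm_circleMap_zero, abs_of_pos hs0])
    simpa only [mul_pow, mul_assoc] using h
  have hnorm : ∀ j : ℕ, ‖((j + p).choose p : ℂ) * conj z ^ j‖ = ((j + p).choose p : ℝ) * r ^ j := by
    intro j
    rw [norm_mul, norm_pow, RCLike.norm_conj, hzr, Complex.norm_natCast]
  have hsum : Summable fun j : ℕ => ‖((j + p).choose p : ℂ) * conj z ^ j‖ * |s| ^ j := by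
    simp_rw [hnorm, abs_of_pos hs0, mul_assoc, ← mul_pow]
    exact summable_norm_choose_mul_pow p (by positivity) hrs
  have h := (hasSum_integral_norm_sq_powerSeries
    (F := fun w : ℂ => 1 / (1 - conj z * w) ^ (p + 1)) hsum hF).mul_left
    (((1 - r ^ 2) * (1 - s ^ 2)) ^ (p + 1) / (4 * (κ + 1 : ℝ) ^ 2))
  rw [← integral_const_mul] at h
  have hk : (κ : ℝ) + 1 ≠ 0 := by positivity
  convert! h using 1
  · ext j
    rw [hnorm, mul_pow (1 - r ^ 2), mul_pow, pow_mul s, ← pow_mul r j 2, mul_comm j 2, pow_mul r]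
    field_simp
    ring
  · congr 1 with φ
    unfold corrSq
    rw [hzr, norm_circleMap_zero, abs_of_pos hs0, ← pow_mul, ← hp, norm_div, norm_one, norm_pow,
      div_pow, div_pow, ← pow_mul, ← pow_mul, mul_comm (p + 1) 2]
    field_simp

theorem chaosCoord_nonneg (ℓ : ℕ) (q : ℕ × ℕ) {τ : ℝ} (hτ : τ < 0) : 0 ≤ chaosCoord ℓ q τ := by
  have : 0 < 1 - Real.exp (2 * τ) := sub_pos.2 (Real.exp_lt_one_iff.2 (by linarith))
  unfold chaosCoord
  positivity

theorem hasSum_chaosCoord_mul (ℓ : ℕ) {r s : ℝ} (hr0 : 0 < r) (hr1 : r < 1) (hs0 : 0 < s)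
    (hs1 : s < 1) {Λ : ℝ → ℝ → ℝ}
    (hΛ : ∀ θ φ, HasSum (fun κ : ℕ => corrSq ℓ (circleMap 0 r θ) (circleMap 0 s φ) ^ (κ + 1) /
      (4 * (κ + 1 : ℝ) ^ 2)) (Λ θ φ)) :
    HasSum (fun q => chaosCoord ℓ q (Real.log r) * chaosCoord ℓ q (Real.log s))
      (∫ θ, ∫ φ, Λ θ φ ∂angleMeasure ∂angleMeasure) := by
  have hlr := Real.log_neg hr0 hr1
  have hls := Real.log_neg hs0 hs1
  have hz : ∀ θ, ‖circleMap 0 r θ‖ < 1 := fun θ => by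
    rwa [norm_circleMap_zero, abs_of_pos hr0]
  have hw : ∀ θ, ‖circleMap 0 s θ‖ < 1 := fun θ => by
    rwa [norm_circleMap_zero, abs_of_pos hs0]
  have key : ∀ θ, HasSum (fun κ : ℕ => ∫ φ, corrSq ℓ (circleMap 0 r θ) (circleMap 0 s φ) ^ (κ + 1) /
      (4 * (κ + 1 : ℝ) ^ 2) ∂angleMeasure) (∫ φ, Λ θ φ ∂angleMeasure) := by
    intro θ
    refine hasSum_integral_of_dominated_convergence
      (fun κ _ => 1 / (4 * (κ + 1 : ℝ) ^ 2)) (fun κ => ?_) (fun κ => ?_) ?_ ?_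
      (ae_of_all _ fun φ => hΛ θ φ)
    · unfold corrSq
      exact (Measurable.aestronglyMeasurable (by fun_prop))
    · refine ae_of_all _ fun φ => ?_
      have h0 := corrSq_nonneg ℓ (hz θ) (hw φ)
      rw [Real.norm_of_nonneg (by positivity)]
      gcongr
      exact pow_le_one₀ h0 (corrSq_le_one ℓ (hz θ) (hw φ))
    · refine ae_of_all _ fun φ => ?_
      refine ((summable_pow_div_sq zero_le_one le_rfl).mul_left (1 / 4)).congr fun κ => ?_
      rw [one_pow]
      field_simp
    · exact integrable_const _
  -- The inner mean is constant in θ, being the sum of a series independent of θ, so the outer mean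
  -- is trivial.
  have hconst : ∀ θ, ∫ φ, Λ θ φ ∂angleMeasure = ∫ φ, Λ 0 φ ∂angleMeasure := by
    intro θ
    refine (key θ).unique ?_
    convert! key 0 using 1
    ext κ
    exact (hasSum_integral_corrSq_pow ℓ κ hr0 hr1 hs0 hs1 θ).unique
      (hasSum_integral_corrSq_pow ℓ κ hr0 hr1 hs0 hs1 0)
  simp_rw [hconst]
  rw [integral_const, probReal_univ, one_smul]
  exact hasSum_prod_of_nonneg
    (fun q => mul_nonneg (chaosCoord_nonneg ℓ q hlr) (chaosCoord_nonneg ℓ q hls))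
    (fun κ => hasSum_integral_corrSq_pow ℓ κ hr0 hr1 hs0 hs1 0) (key 0)

/-! ### Averages of square integrable processes and limits of variances -/

/-- Fubini's theorem for the product of two averages of square integrable processes. -/
theorem integral_mul_integral_eq {Ω T : Type*} [MeasurableSpace Ω] [MeasurableSpace T]
    {P : Measure Ω} [IsProbabilityMeasure P] {ν : Measure T} [IsProbabilityMeasure ν]
    {U V : Ω × T → ℝ} (hU : MemLp U 2 (P.prod ν)) (hV : MemLp V 2 (P.prod ν)) :
    Integrable (fun ω => (∫ θ, U (ω, θ) ∂ν) * ∫ φ, V (ω, φ) ∂ν) P ∧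
      ∫ ω, (∫ θ, U (ω, θ) ∂ν) * ∫ φ, V (ω, φ) ∂ν ∂P =
        ∫ θ, ∫ φ, ∫ ω, U (ω, θ) * V (ω, φ) ∂P ∂ν ∂ν := by
  have m1 : MeasurePreserving (Prod.map id Prod.fst : Ω × (T × T) → Ω × T)
      (P.prod (ν.prod ν)) (P.prod ν) := (MeasurePreserving.id P).prod measurePreserving_fst
  have m2 : MeasurePreserving (Prod.map id Prod.snd : Ω × (T × T) → Ω × T)
      (P.prod (ν.prod ν)) (P.prod ν) := (MeasurePreserving.id P).prod measurePreserving_snd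
  have hj : Integrable (fun q : Ω × (T × T) => U (q.1, q.2.1) * V (q.1, q.2.2))
      (P.prod (ν.prod ν)) :=
    MemLp.integrable_mul (hU.comp_measurePreserving m1) (hV.comp_measurePreserving m2)
  have heq : ∀ ω, (∫ θ, U (ω, θ) ∂ν) * ∫ φ, V (ω, φ) ∂ν =
      ∫ q : T × T, U (ω, q.1) * V (ω, q.2) ∂(ν.prod ν) := fun ω =>
    (integral_prod_mul (fun θ => U (ω, θ)) (fun φ => V (ω, φ))).symm
  simp_rw [heq]
  refine ⟨hj.integral_prod_left, ?_⟩
  rw [integral_integral_swap hj]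
  exact integral_prod _ hj.integral_prod_right

theorem memLp_integral_right {Ω T : Type*} [MeasurableSpace Ω] [MeasurableSpace T]
    {P : Measure Ω} [IsProbabilityMeasure P] {ν : Measure T} [IsProbabilityMeasure ν]
    {U : Ω × T → ℝ} (hU : MemLp U 2 (P.prod ν)) : MemLp (fun ω => ∫ θ, U (ω, θ) ∂ν) 2 P := by
  rw [memLp_two_iff_integrable_sq hU.1.integral_prod_right']
  simpa only [sq] using (integral_mul_integral_eq hU hU).1

/-- Convergence of the variance for a dominated approximation. -/
theorem variance_eq_of_tendsto {Ω : Type*} [MeasurableSpace Ω] {P : Measure Ω}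
    [IsProbabilityMeasure P] {N : Ω → ℝ} {D : ℕ → Ω → ℝ} (hD : ∀ k, MemLp (D k) 2 P)
    (h0 : ∀ k, ∀ᵐ ω ∂P, 0 ≤ D k ω) (hDN : ∀ k, ∀ᵐ ω ∂P, D k ω ≤ N ω)
    (hlim : ∀ᵐ ω ∂P, Tendsto (fun k => D k ω) atTop (𝓝 (N ω))) {V M : ℝ}
    (hV : Tendsto (fun k => ∫ ω, D k ω ^ 2 ∂P - (∫ ω, D k ω ∂P) ^ 2) atTop (𝓝 V))
    (hM : Tendsto (fun k => ∫ ω, D k ω ∂P) atTop (𝓝 M)) :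
    MemLp N 2 P ∧ variance N P = V := by
  have hNm : AEStronglyMeasurable N P := aestronglyMeasurable_of_tendsto_ae atTop
    (fun k => (hD k).1) hlim
  have hB : Tendsto (fun k => ∫ ω, D k ω ^ 2 ∂P) atTop (𝓝 (V + M ^ 2)) := by
    simpa using hV.add (hM.pow 2)
  have hN : MemLp N 2 P := by
    rw [memLp_two_iff_integrable_sq hNm]
    refine ⟨hNm.pow 2, ?_⟩
    rw [hasFiniteIntegral_iff_ofReal (ae_of_all _ fun ω => sq_nonneg _)]
    -- Fatou's lemma bounds the second moment of the limit. Once N is in L², it dominates the whole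
    -- sequence.
    have h1 : ∫⁻ ω, ENNReal.ofReal (N ω ^ 2) ∂P ≤
        liminf (fun k => ∫⁻ ω, ENNReal.ofReal (D k ω ^ 2) ∂P) atTop := by
      refine le_trans (lintegral_mono_ae ?_) (lintegral_liminf_le' fun k =>
        ((hD k).1.aemeasurable.pow_const 2).ennreal_ofReal)
      filter_upwards [hlim] with ω h
      exact (Tendsto.liminf_eq (ENNReal.tendsto_ofReal (h.pow 2))).ge
    have h2 : Tendsto (fun k => ∫⁻ ω, ENNReal.ofReal (D k ω ^ 2) ∂P) atTop
        (𝓝 (ENNReal.ofReal (V + M ^ 2))) := by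
      refine (ENNReal.tendsto_ofReal hB).congr fun k => ?_
      exact ofReal_integral_eq_lintegral_ofReal (hD k).integrable_sq
        (ae_of_all _ fun ω => sq_nonneg _)
    rw [h2.liminf_eq] at h1
    exact h1.trans_lt ENNReal.ofReal_lt_top
  refine ⟨hN, ?_⟩
  have t1 : Tendsto (fun k => ∫ ω, D k ω ∂P) atTop (𝓝 (∫ ω, N ω ∂P)) := by
    refine tendsto_integral_of_dominated_convergence N (fun k => (hD k).1)
      (hN.integrable one_le_two) (fun k => ?_) hlim
    filter_upwards [h0 k, hDN k] with ω h1 h2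
    rwa [Real.norm_of_nonneg h1]
  have t2 : Tendsto (fun k => ∫ ω, D k ω ^ 2 ∂P) atTop (𝓝 (∫ ω, N ω ^ 2 ∂P)) := by
    refine tendsto_integral_of_dominated_convergence (fun ω => N ω ^ 2)
      (fun k => (hD k).1.pow 2) hN.integrable_sq (fun k => ?_) (hlim.mono fun ω h => h.pow 2)
    filter_upwards [h0 k, hDN k] with ω h1 h2
    rw [Real.norm_of_nonneg (sq_nonneg _)]
    exact pow_le_pow_left₀ h1 h2 2
  rw [variance_eq_sub hN]
  exact tendsto_nhds_unique (t2.sub (t1.pow 2)) hV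

/-! ### The hyperbolic Gaussian analytic function -/

theorem gammaBinom_natCast_add_one (ℓ n : ℕ) :
    gammaBinom (ℓ + 1) n = ((n + ℓ).choose ℓ : ℝ) := by
  rw [gammaBinom, show (ℓ : ℝ) + 1 + n = ((n + ℓ : ℕ) : ℝ) + 1 by push_cast; ring,
    Real.Gamma_nat_eq_factorial, Real.Gamma_nat_eq_factorial, Real.Gamma_nat_eq_factorial,
    Nat.cast_choose ℝ (Nat.le_add_left ℓ n), Nat.add_sub_cancel, mul_comm (n.factorial : ℝ)]

theorem ae_summable_of_summable_integral_norm {Ω : Type*} [MeasurableSpace Ω] {P : Measure Ω}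
    {F : ℕ → Ω → ℝ} (hF : ∀ n, Integrable (F n) P) (hF0 : ∀ n ω, 0 ≤ F n ω)
    (hs : Summable fun n => ∫ ω, F n ω ∂P) : ∀ᵐ ω ∂P, Summable fun n => F n ω := by
  have h1 : ∫⁻ ω, ∑' n, ENNReal.ofReal (F n ω) ∂P ≠ ⊤ := by
    rw [lintegral_tsum fun n => (hF n).1.aemeasurable.ennreal_ofReal]
    have : ∀ n, ∫⁻ ω, ENNReal.ofReal (F n ω) ∂P = ENNReal.ofReal (∫ ω, F n ω ∂P) := fun n =>
      (ofReal_integral_eq_lintegral_ofReal (hF n) (ae_of_all _ (hF0 n))).symm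
    simp_rw [this]
    rw [← ENNReal.ofReal_tsum_of_nonneg (fun n => integral_nonneg (hF0 n)) hs]
    exact ENNReal.ofReal_ne_top
  have h2 := ae_lt_top' (AEMeasurable.tsum fun n => (hF n).1.aemeasurable.ennreal_ofReal) h1
  filter_upwards [h2] with ω h
  refine (ENNReal.summable_toReal h.ne).congr fun n => ENNReal.toReal_ofReal (hF0 n ω)

section GAF

variable {Ω : Type*} [MeasurableSpace Ω] {P : Measure Ω} {a : ℕ → Ω → ℂ} {ℓ : ℕ}

/-- The absolute convergence of the hyperbolic Gaussian power series at radius `R`. -/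
def GAFSummable (ℓ : ℕ) (b : ℕ → ℂ) (R : ℝ) : Prop :=
  Summable fun n => ‖b n‖ * (Real.sqrt (gammaBinom (ℓ + 1) n) * R ^ n)

/-- E‖aₙ‖ does not depend on n, so the expected sum is finite by comparison with the binomial
series; the square root of a binomial coefficient is at most the coefficient itself. -/
theorem ae_gafSummable (hlaw : ∀ n, HasLaw (a n) stdComplexNormal P) {R : ℝ} (hR0 : 0 ≤ R)
    (hR1 : R < 1) : ∀ᵐ ω ∂P, GAFSummable ℓ (fun n => a n ω) R := by
  have hnorm : ∀ n, ∫ ω, ‖a n ω‖ ∂P = ∫ x, ‖x‖ ∂stdComplexNormal := fun n => by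
    rw [← (hlaw n).map_eq, integral_map (hlaw n).aemeasurable
      (Measurable.aestronglyMeasurable (by fun_prop))]
  have hint : ∀ n, Integrable (fun ω => ‖a n ω‖) P := fun n => by
    have h := integrable_norm_stdComplexNormal
    rw [← (hlaw n).map_eq] at h
    exact h.comp_aemeasurable (hlaw n).aemeasurable
  refine ae_summable_of_summable_integral_norm (fun n => (hint n).mul_const _)
    (fun n ω => by positivity) ?_
  simp_rw [integral_mul_const, hnorm]
  refine Summable.mul_left _ ?_
  refine Summable.of_nonneg_of_le (fun n => by positivity) (fun n => ?_)
    (summable_norm_choose_mul_pow ℓ hR0 hR1)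
  rw [gammaBinom_natCast_add_one]
  gcongr
  have h1 : (1 : ℝ) ≤ ((n + ℓ).choose ℓ : ℝ) := by
    exact_mod_cast Nat.choose_pos (Nat.le_add_left ℓ n)
  exact Real.sqrt_le_iff.2 ⟨by positivity, by nlinarith⟩

theorem norm_gaf_term_le {b : ℕ → ℂ} {R : ℝ} {z : ℂ} (hz : ‖z‖ ≤ R) (n : ℕ) :
    ‖b n * (Real.sqrt (gammaBinom (ℓ + 1) n) : ℂ) * z ^ n‖ ≤
      ‖b n‖ * (Real.sqrt (gammaBinom (ℓ + 1) n) * R ^ n) := by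
  rw [norm_mul, norm_mul, norm_pow, Complex.norm_real, Real.norm_of_nonneg (Real.sqrt_nonneg _),
    mul_assoc]
  gcongr

theorem GAFSummable.hasSum {b : ℕ → ℂ} {R : ℝ} (h : GAFSummable ℓ b R) {z : ℂ} (hz : ‖z‖ ≤ R) :
    HasSum (fun n => b n * (Real.sqrt (gammaBinom (ℓ + 1) n) : ℂ) * z ^ n)
      (hyperbolicGAF (ℓ + 1) b z) :=
  (Summable.of_norm_bounded h (norm_gaf_term_le hz)).hasSum

theorem GAFSummable.analyticOnNhd {b : ℕ → ℂ} {R : ℝ} (h : GAFSummable ℓ b R) :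
    AnalyticOnNhd ℂ (hyperbolicGAF (ℓ + 1) b) (Metric.ball 0 R) := by
  refine DifferentiableOn.analyticOnNhd ?_ Metric.isOpen_ball
  refine Complex.differentiableOn_tsum_of_summable_norm h (fun n => by fun_prop) Metric.isOpen_ball
    fun n z hz => norm_gaf_term_le (mem_ball_zero_iff.1 hz).le n

theorem hyperbolicGAF_zero {b : ℕ → ℂ} : hyperbolicGAF (ℓ + 1) b 0 = b 0 := by
  rw [hyperbolicGAF, tsum_eq_single 0 fun n hn => by simp [hn], gammaBinom_natCast_add_one]
  simp

/-- The normalizing factor `(1 - r²)^{L/2}` on the circle of radius `r`. -/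
noncomputable def gafScale (ℓ : ℕ) (r : ℝ) : ℝ := Real.sqrt ((1 - r ^ 2) ^ (ℓ + 1))

theorem gafScale_pos {r : ℝ} (hr0 : 0 ≤ r) (hr1 : r < 1) : 0 < gafScale ℓ r :=
  Real.sqrt_pos.2 (pow_pos (by nlinarith) _)

theorem gafScale_sq {r : ℝ} (hr0 : 0 ≤ r) (hr1 : r < 1) :
    gafScale ℓ r ^ 2 = (1 - r ^ 2) ^ (ℓ + 1) :=
  Real.sq_sqrt (pow_nonneg (by nlinarith) _)

/-- The normalized coefficients of the value at `z` of the hyperbolic Gaussian analytic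
function. -/
noncomputable def gafCoeff (ℓ : ℕ) (z : ℂ) (n : ℕ) : ℂ :=
  (gafScale ℓ ‖z‖ : ℂ) * ((Real.sqrt (gammaBinom (ℓ + 1) n) : ℂ) * z ^ n)

/-- The covariance kernel is the negative binomial series ∑ C(n + ℓ, ℓ) (conj z · w)ⁿ, multiplied by
the normalizing factors. -/
theorem hasSum_conj_gafCoeff_mul {z w : ℂ} (hz : ‖z‖ < 1) (hw : ‖w‖ < 1) :
    HasSum (fun n => conj (gafCoeff ℓ z n) * gafCoeff ℓ w n)
      (gafScale ℓ ‖z‖ * gafScale ℓ ‖w‖ * (1 / (1 - conj z * w) ^ (ℓ + 1))) := by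
  have h := (hasSum_choose_mul_geometric_of_norm_lt_one ℓ (r := conj z * w) (by
    rw [norm_mul, RCLike.norm_conj]
    nlinarith [norm_nonneg z, norm_nonneg w])).mul_left
      ((gafScale ℓ ‖z‖ : ℂ) * gafScale ℓ ‖w‖)
  convert! h using 1
  ext n
  have hs : (Real.sqrt (gammaBinom (ℓ + 1) n) : ℂ) * Real.sqrt (gammaBinom (ℓ + 1) n) =
      ((n + ℓ).choose ℓ : ℂ) := by
    rw [gammaBinom_natCast_add_one, ← Complex.ofReal_mul, Real.mul_self_sqrt (Nat.cast_nonneg _)]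
    norm_cast
  unfold gafCoeff
  rw [← hs, map_mul, map_mul, map_pow, Complex.conj_ofReal, Complex.conj_ofReal]
  ring

theorem hasSum_norm_gafCoeff_sq {z : ℂ} (hz : ‖z‖ < 1) :
    HasSum (fun n => ‖gafCoeff ℓ z n‖ ^ 2) 1 := by
  have h := hasSum_conj_gafCoeff_mul (ℓ := ℓ) hz hz
  have h1 : (gafScale ℓ ‖z‖ * gafScale ℓ ‖z‖ * (1 / (1 - conj z * z) ^ (ℓ + 1)) : ℂ) =
      ((1 : ℝ) : ℂ) := by
    rw [Complex.conj_mul', ← Complex.ofReal_mul, ← sq, gafScale_sq (norm_nonneg z) hz]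
    have : (1 - ‖z‖ ^ 2) ^ (ℓ + 1) ≠ 0 := pow_ne_zero _ (by nlinarith [norm_nonneg z])
    have h2 : (1 - (‖z‖ : ℂ) ^ 2) ^ (ℓ + 1) ≠ 0 := by exact_mod_cast this
    push_cast
    field_simp
  rw [h1] at h
  refine Complex.hasSum_ofReal.1 (h.congr_fun fun n => ?_)
  rw [Complex.conj_mul']
  push_cast
  rfl

theorem norm_sq_gaf_correlation {z w : ℂ} (hz : ‖z‖ < 1) (hw : ‖w‖ < 1) :
    ‖(gafScale ℓ ‖z‖ * gafScale ℓ ‖w‖ * (1 / (1 - conj z * w) ^ (ℓ + 1)) : ℂ)‖ ^ 2 =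
      corrSq ℓ z w := by
  rw [norm_mul, norm_mul, Complex.norm_real, Complex.norm_real, Real.norm_eq_abs, Real.norm_eq_abs,
    mul_pow, mul_pow, sq_abs, sq_abs, gafScale_sq (norm_nonneg z) hz,
    gafScale_sq (norm_nonneg w) hw, norm_div, norm_one, norm_pow, corrSq, div_pow, div_pow,
    ← pow_mul, ← pow_mul, mul_pow, mul_comm (ℓ + 1) 2]
  ring

/-- The mean of `log |f|` on the circle of radius `r`. -/
noncomputable def gafLogMean (ℓ : ℕ) (r : ℝ) : ℝ := logNormMean - Real.log (gafScale ℓ r)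

/-- The centred logarithm of the modulus of the hyperbolic Gaussian analytic function on the circle
of radius `r`. -/
noncomputable def gafLog (ℓ : ℕ) (a : ℕ → Ω → ℂ) (r : ℝ) (q : Ω × ℝ) : ℝ :=
  Real.log ‖hyperbolicGAF (ℓ + 1) (fun n => a n q.1) (circleMap 0 r q.2)‖ - gafLogMean ℓ r

theorem aestronglyMeasurable_gafLog (hlaw : ∀ n, HasLaw (a n) stdComplexNormal P)
    {r : ℝ} (hr0 : 0 ≤ r) (hr1 : r < 1) :
    AEStronglyMeasurable (gafLog ℓ a r) (P.prod angleMeasure) := by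
  have hm : AEMeasurable (fun q : Ω × ℝ =>
      hyperbolicGAF (ℓ + 1) (fun n => a n q.1) (circleMap 0 r q.2)) (P.prod angleMeasure) := by
    refine aemeasurable_of_tendsto_metrizable_ae' (f := fun N (q : Ω × ℝ) =>
      ∑ n ∈ Finset.range N, a n q.1 * (Real.sqrt (gammaBinom (ℓ + 1) n) : ℂ) *
        circleMap 0 r q.2 ^ n) (fun N => ?_) ?_
    · refine Finset.aemeasurable_fun_sum _ fun n _ => ?_
      refine AEMeasurable.mul ((hlaw n).aemeasurable.comp_quasiMeasurePreserving
        Measure.quasiMeasurePreserving_fst |>.mul_const _) ?_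
      exact Measurable.aemeasurable (by fun_prop)
    · filter_upwards [Measure.quasiMeasurePreserving_fst.ae (ae_gafSummable (ℓ := ℓ) hlaw hr0 hr1)]
        with q hq
      exact (hq.hasSum (by rw [norm_circleMap_zero, abs_of_nonneg hr0])).tendsto_sum_nat
  exact ((Real.measurable_log.comp_aemeasurable hm.norm).sub_const _).aestronglyMeasurable

variable [IsProbabilityMeasure P]

theorem hasLaw_gaf_pair (hlaw : ∀ n, HasLaw (a n) stdComplexNormal P) (hindep : iIndepFun a P)
    {z w : ℂ} (hz : ‖z‖ < 1) (hw : ‖w‖ < 1) :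
    ∃ (ρ : ℂ) (σ : ℝ), ‖ρ‖ ^ 2 + σ ^ 2 = 1 ∧ ‖ρ‖ ^ 2 = corrSq ℓ z w ∧
      HasLaw (fun ω => ((gafScale ℓ ‖z‖ : ℂ) * hyperbolicGAF (ℓ + 1) (fun n => a n ω) z,
        (gafScale ℓ ‖w‖ : ℂ) * hyperbolicGAF (ℓ + 1) (fun n => a n ω) w))
        (complexNormalPair ρ σ) P := by
  have hsum : ∀ z : ℂ, ‖z‖ < 1 → ∀ᵐ ω ∂P, HasSum (fun n => a n ω * gafCoeff ℓ z n)
      ((gafScale ℓ ‖z‖ : ℂ) * hyperbolicGAF (ℓ + 1) (fun n => a n ω) z) := by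
    intro z hz
    filter_upwards [ae_gafSummable (ℓ := ℓ) hlaw (norm_nonneg z) hz] with ω h
    refine ((h.hasSum le_rfl).mul_left (gafScale ℓ ‖z‖ : ℂ)).congr_fun fun n => ?_
    unfold gafCoeff
    ring
  have hσ : ‖(gafScale ℓ ‖z‖ * gafScale ℓ ‖w‖ * (1 / (1 - conj z * w) ^ (ℓ + 1)) : ℂ)‖ ^ 2 +
      Real.sqrt (1 - corrSq ℓ z w) ^ 2 = 1 := by
    rw [norm_sq_gaf_correlation hz hw, Real.sq_sqrt (sub_nonneg.2 (corrSq_le_one ℓ hz hw))]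
    ring
  exact ⟨_, _, hσ, norm_sq_gaf_correlation hz hw, hasLaw_gaussianSeries_pair hlaw hindep
    (hsum z hz) (hsum w hw) hσ (hasSum_norm_gafCoeff_sq hz) (hasSum_norm_gafCoeff_sq hw)
    (hasSum_conj_gafCoeff_mul hz hw)⟩

theorem hasLaw_gaf (hlaw : ∀ n, HasLaw (a n) stdComplexNormal P) (hindep : iIndepFun a P)
    {z : ℂ} (hz : ‖z‖ < 1) :
    HasLaw (fun ω => (gafScale ℓ ‖z‖ : ℂ) * hyperbolicGAF (ℓ + 1) (fun n => a n ω) z)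
      stdComplexNormal P := by
  obtain ⟨ρ, σ, -, -, h⟩ := hasLaw_gaf_pair (ℓ := ℓ) hlaw hindep hz hz
  have h1 : HasLaw Prod.fst stdComplexNormal (complexNormalPair ρ σ) :=
    ⟨measurable_fst.aemeasurable, map_fst_complexNormalPair ρ σ⟩
  exact h1.fun_comp h

/-- The logarithm of the product splits only where f does not vanish, which at a fixed point holds
almost surely because f there is a nonzero multiple of a normal variable. -/
theorem ae_gafLog_eq (hlaw : ∀ n, HasLaw (a n) stdComplexNormal P) (hindep : iIndepFun a P)
    {r : ℝ} (hr0 : 0 ≤ r) (hr1 : r < 1) (θ : ℝ) :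
    ∀ᵐ ω ∂P, gafLog ℓ a r (ω, θ) = Real.log ‖(gafScale ℓ ‖circleMap 0 r θ‖ : ℂ) *
      hyperbolicGAF (ℓ + 1) (fun n => a n ω) (circleMap 0 r θ)‖ - logNormMean := by
  have hz : ‖circleMap 0 r θ‖ = r := by rw [norm_circleMap_zero, abs_of_nonneg hr0]
  have h := hasLaw_gaf (ℓ := ℓ) hlaw hindep (z := circleMap 0 r θ) (by rwa [hz])
  have hne : ∀ᵐ x ∂P.map (fun ω => (gafScale ℓ ‖circleMap 0 r θ‖ : ℂ) *
      hyperbolicGAF (ℓ + 1) (fun n => a n ω) (circleMap 0 r θ)), x ≠ 0 := by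
    rw [h.map_eq]
    exact ae_ne_zero_stdComplexNormal
  filter_upwards [ae_of_ae_map h.aemeasurable hne] with ω hω
  have h1 := right_ne_zero_of_mul hω
  have hs := gafScale_pos (ℓ := ℓ) hr0 hr1
  rw [hz, norm_mul, Complex.norm_real, Real.norm_of_nonneg hs.le,
    Real.log_mul hs.ne' (norm_ne_zero_iff.2 h1), gafLog, gafLogMean]
  ring

theorem integral_comp_gafLog (hlaw : ∀ n, HasLaw (a n) stdComplexNormal P)
    (hindep : iIndepFun a P) {r : ℝ} (hr0 : 0 ≤ r) (hr1 : r < 1) {g : ℝ → ℝ} (hg : Measurable g)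
    (hgi : Integrable (fun x => g (Real.log ‖x‖ - logNormMean)) stdComplexNormal) (θ : ℝ) :
    Integrable (fun ω => g (gafLog ℓ a r (ω, θ))) P ∧
      ∫ ω, g (gafLog ℓ a r (ω, θ)) ∂P =
        ∫ x, g (Real.log ‖x‖ - logNormMean) ∂stdComplexNormal := by
  have h := hasLaw_gaf (ℓ := ℓ) hlaw hindep (z := circleMap 0 r θ)
    (by rwa [norm_circleMap_zero, abs_of_nonneg hr0])
  have hae := ae_gafLog_eq (ℓ := ℓ) hlaw hindep hr0 hr1 θ
  constructor
  · rw [← h.map_eq] at hgi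
    refine (hgi.comp_aemeasurable h.aemeasurable).congr ?_
    filter_upwards [hae] with ω hω
    rw [hω]
    rfl
  · rw [← h.map_eq, integral_map h.aemeasurable (Measurable.aestronglyMeasurable (by fun_prop))]
    refine integral_congr_ae ?_
    filter_upwards [hae] with ω hω
    rw [hω]

theorem memLp_gafLog (hlaw : ∀ n, HasLaw (a n) stdComplexNormal P) (hindep : iIndepFun a P)
    {r : ℝ} (hr0 : 0 ≤ r) (hr1 : r < 1) : MemLp (gafLog ℓ a r) 2 (P.prod angleMeasure) := by
  have hm := aestronglyMeasurable_gafLog (ℓ := ℓ) hlaw hr0 hr1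
  have hsq : Integrable (fun x : ℂ => (Real.log ‖x‖ - logNormMean) ^ 2) stdComplexNormal :=
    (memLp_log_norm_stdComplexNormal.sub (memLp_const _)).integrable_sq
  rw [memLp_two_iff_integrable_sq hm]
  refine (integrable_prod_iff' (hm.pow 2)).2 ?_
  have h := integral_comp_gafLog (ℓ := ℓ) hlaw hindep hr0 hr1 (g := fun x => x ^ 2)
    (by fun_prop) hsq
  refine ⟨ae_of_all _ fun θ => (h θ).1, ?_⟩
  simp only [Real.norm_eq_abs, Pi.pow_apply, abs_of_nonneg (sq_nonneg (gafLog ℓ a r _))]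
  simp_rw [(h _).2]
  exact integrable_const _

/-- The circular mean of the centred logarithm. -/
noncomputable def gafLogAverage (ℓ : ℕ) (a : ℕ → Ω → ℂ) (r : ℝ) (ω : Ω) : ℝ :=
  ∫ θ, gafLog ℓ a r (ω, θ) ∂angleMeasure

theorem memLp_gafLogAverage (hlaw : ∀ n, HasLaw (a n) stdComplexNormal P) (hindep : iIndepFun a P)
    {r : ℝ} (hr0 : 0 ≤ r) (hr1 : r < 1) : MemLp (gafLogAverage ℓ a r) 2 P :=
  memLp_integral_right (memLp_gafLog hlaw hindep hr0 hr1)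

theorem integral_gafLogAverage (hlaw : ∀ n, HasLaw (a n) stdComplexNormal P)
    (hindep : iIndepFun a P) {r : ℝ} (hr0 : 0 ≤ r) (hr1 : r < 1) :
    ∫ ω, gafLogAverage ℓ a r ω ∂P = 0 := by
  have hl := (memLp_log_norm_stdComplexNormal).integrable one_le_two
  have h := integral_comp_gafLog (ℓ := ℓ) hlaw hindep hr0 hr1 (g := fun x => x)
    (by fun_prop) (hl.sub (integrable_const _))
  unfold gafLogAverage
  rw [integral_integral_swap (f := fun ω θ => gafLog ℓ a r (ω, θ))
    ((memLp_gafLog (ℓ := ℓ) hlaw hindep hr0 hr1).integrable one_le_two)]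
  simp_rw [(h _).2]
  rw [integral_sub hl (integrable_const _)]
  simp [logNormMean]

/-- Fubini's theorem reduces the covariance of two circular means to a double mean of the two-point
covariances of log |f|, which the chaos coordinates diagonalize. -/
theorem hasSum_integral_gafLogAverage_mul (hlaw : ∀ n, HasLaw (a n) stdComplexNormal P)
    (hindep : iIndepFun a P) {r s : ℝ} (hr0 : 0 < r) (hr1 : r < 1) (hs0 : 0 < s) (hs1 : s < 1) :
    HasSum (fun q => chaosCoord ℓ q (Real.log r) * chaosCoord ℓ q (Real.log s))
      (∫ ω, gafLogAverage ℓ a r ω * gafLogAverage ℓ a s ω ∂P) := by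
  unfold gafLogAverage
  rw [(integral_mul_integral_eq (memLp_gafLog hlaw hindep hr0.le hr1)
    (memLp_gafLog hlaw hindep hs0.le hs1)).2]
  refine hasSum_chaosCoord_mul ℓ hr0 hr1 hs0 hs1 fun θ φ => ?_
  obtain ⟨ρ, σ, hσ, hρ, h⟩ := hasLaw_gaf_pair (ℓ := ℓ) hlaw hindep
    (z := circleMap 0 r θ) (w := circleMap 0 s φ)
    (by rwa [norm_circleMap_zero, abs_of_pos hr0]) (by rwa [norm_circleMap_zero, abs_of_pos hs0])
  have hs := hasSum_integral_log_mul_log hσ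
  rw [hρ, ← h.map_eq, integral_map h.aemeasurable
    (Measurable.aestronglyMeasurable (by fun_prop))] at hs
  convert! hs using 1
  refine integral_congr_ae ?_
  filter_upwards [ae_gafLog_eq (ℓ := ℓ) hlaw hindep hr0.le hr1 θ,
    ae_gafLog_eq (ℓ := ℓ) hlaw hindep hs0.le hs1 φ] with ω h1 h2
  rw [h1, h2]

theorem hasSum_integral_gafLogAverage_sub_sq (hlaw : ∀ n, HasLaw (a n) stdComplexNormal P)
    (hindep : iIndepFun a P) {r s : ℝ} (hr0 : 0 < r) (hr1 : r < 1) (hs0 : 0 < s) (hs1 : s < 1) :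
    HasSum (fun q => (chaosCoord ℓ q (Real.log r) - chaosCoord ℓ q (Real.log s)) ^ 2)
      (∫ ω, (gafLogAverage ℓ a r ω - gafLogAverage ℓ a s ω) ^ 2 ∂P) := by
  have mr := memLp_gafLogAverage (ℓ := ℓ) hlaw hindep hr0.le hr1
  have ms := memLp_gafLogAverage (ℓ := ℓ) hlaw hindep hs0.le hs1
  have irr : Integrable (fun ω => gafLogAverage ℓ a r ω * gafLogAverage ℓ a r ω) P :=
    mr.integrable_mul mr
  have irs : Integrable (fun ω => gafLogAverage ℓ a r ω * gafLogAverage ℓ a s ω) P :=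
    mr.integrable_mul ms
  have iss : Integrable (fun ω => gafLogAverage ℓ a s ω * gafLogAverage ℓ a s ω) P :=
    ms.integrable_mul ms
  have i3 : Integrable (fun ω => gafLogAverage ℓ a r ω * gafLogAverage ℓ a r ω -
      2 * (gafLogAverage ℓ a r ω * gafLogAverage ℓ a s ω)) P := irr.sub (irs.const_mul 2)
  have h := ((hasSum_integral_gafLogAverage_mul (ℓ := ℓ) hlaw hindep hr0 hr1 hr0 hr1).sub
    ((hasSum_integral_gafLogAverage_mul (ℓ := ℓ) hlaw hindep hr0 hr1 hs0 hs1).mul_left 2)).add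
    (hasSum_integral_gafLogAverage_mul (ℓ := ℓ) hlaw hindep hs0 hs1 hs0 hs1)
  convert! h using 1
  · ext q
    ring
  · rw [← integral_const_mul, ← integral_sub irr (irs.const_mul 2), ← integral_add i3 iss]
    congr 1 with ω
    ring

/-- Only the existence of the derivative matters: it makes the expected slopes converge, and its
value drops out of the variance. -/
theorem hasDerivAt_gafLogMean_exp {τ : ℝ} (hτ : τ < 0) :
    ∃ m, HasDerivAt (fun τ => gafLogMean ℓ (Real.exp τ)) m τ := by
  have h : DifferentiableAt ℝ (fun τ => gafLogMean ℓ (Real.exp τ)) τ := by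
    have h1 : Real.exp τ < 1 := Real.exp_lt_one_iff.2 hτ
    have h0 : (1 - Real.exp τ ^ 2) ^ (ℓ + 1) ≠ 0 :=
      (pow_pos (by nlinarith [Real.exp_pos τ]) _).ne'
    unfold gafLogMean gafScale
    have h2 : Real.sqrt ((1 - Real.exp τ ^ 2) ^ (ℓ + 1)) ≠ 0 :=
      (gafScale_pos (ℓ := ℓ) (Real.exp_pos τ).le h1).ne'
    fun_prop (disch := assumption)
  exact ⟨_, h.hasDerivAt⟩

theorem ae_logMeanSlope_eq (hlaw : ∀ n, HasLaw (a n) stdComplexNormal P) (hindep : iIndepFun a P)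
    {r s : ℝ} (hr0 : 0 ≤ r) (hr1 : r < 1) (hs0 : 0 ≤ s) (hs1 : s < 1) :
    ∀ᵐ ω ∂P, logMeanSlope (hyperbolicGAF (ℓ + 1) fun n => a n ω) r s =
      (gafLogAverage ℓ a r ω - gafLogAverage ℓ a s ω + (gafLogMean ℓ r - gafLogMean ℓ s)) /
        (Real.log r - Real.log s) := by
  have key : ∀ r, 0 ≤ r → r < 1 → ∀ᵐ ω ∂P,
      Real.circleAverage (fun z => Real.log ‖hyperbolicGAF (ℓ + 1) (fun n => a n ω) z‖) 0 r =
        gafLogAverage ℓ a r ω + gafLogMean ℓ r := by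
    intro r hr0 hr1
    have hi := (memLp_gafLog (ℓ := ℓ) hlaw hindep hr0 hr1).integrable one_le_two
    filter_upwards [hi.prod_right_ae] with ω hω
    rw [circleAverage_eq_integral_angleMeasure, gafLogAverage]
    have h1 : ∀ θ, Real.log ‖hyperbolicGAF (ℓ + 1) (fun n => a n ω) (circleMap 0 r θ)‖ =
        gafLog ℓ a r (ω, θ) + gafLogMean ℓ r := fun θ => by
      rw [gafLog]; ring
    simp_rw [h1]
    rw [integral_add hω (integrable_const _)]
    simp
  filter_upwards [key r hr0 hr1, key s hs0 hs1] with ω h1 h2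
  rw [logMeanSlope, h1, h2]
  congr 1
  ring

/-- The variance of the number of zeros in a disc, expressed by the derivatives of the chaos
coordinates. -/
theorem variance_gafZeroCount {L : ℝ} (hL : L = ℓ + 1)
    (hlaw : ∀ n, HasLaw (a n) stdComplexNormal P)
    (hindep : iIndepFun a P) {r : ℝ} (hr0 : 0 < r) (hr1 : r < 1) {V : ℝ → ℝ}
    (hV : ∀ τ < 0, HasSum (fun q => chaosCoordDeriv ℓ q τ ^ 2) (V τ))
    (hVc : ContinuousAt V (Real.log r)) :
    MemLp (gafZeroCount L a r) 2 P ∧ variance (gafZeroCount L a r) P = V (Real.log r) := by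
  subst hL
  have hlr := Real.log_neg hr0 hr1
  obtain ⟨t, -, ht, htlim⟩ := exists_seq_strictMono_tendsto' hr0
  have ht1 : ∀ k, t k < 1 := fun k => (ht k).2.trans hr1
  have hΔ : ∀ k, 0 < Real.log r - Real.log (t k) := fun k =>
    sub_pos.2 (Real.log_lt_log (ht k).1 (ht k).2)
  have hτ : Tendsto (fun k => Real.log (t k)) atTop (𝓝[<] Real.log r) :=
    tendsto_nhdsWithin_iff.2 ⟨(Real.continuousAt_log hr0.ne').tendsto.comp htlim,
      Eventually.of_forall fun k => sub_pos.1 (hΔ k)⟩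
  have hgood : ∀ᵐ ω ∂P, AnalyticOnNhd ℂ (hyperbolicGAF (ℓ + 1) fun n => a n ω)
      (Metric.closedBall 0 r) ∧ hyperbolicGAF (ℓ + 1) (fun n => a n ω) 0 ≠ 0 := by
    have h0 : ∀ᵐ x ∂P.map (a 0), x ≠ 0 := by
      rw [(hlaw 0).map_eq]
      exact ae_ne_zero_stdComplexNormal
    -- A radius strictly between r and 1 gives analyticity around the closed disc; f(0) = a₀ is
    -- almost surely nonzero, as Jensen's formula requires.
    filter_upwards [ae_gafSummable (ℓ := ℓ) (R := (1 + r) / 2) hlaw (by linarith) (by linarith),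
      ae_of_ae_map (hlaw 0).aemeasurable h0] with ω h1 h2
    refine ⟨h1.analyticOnNhd.mono (Metric.closedBall_subset_ball (by linarith)), ?_⟩
    rwa [hyperbolicGAF_zero]
  have mr := memLp_gafLogAverage (ℓ := ℓ) hlaw hindep hr0.le hr1
  have mt := fun k => memLp_gafLogAverage (ℓ := ℓ) hlaw hindep (ht k).1.le (ht1 k)
  have mJ : ∀ k, MemLp (fun ω => gafLogAverage ℓ a r ω - gafLogAverage ℓ a (t k) ω) 2 P :=
    fun k => mr.sub (mt k)
  have hslope := fun k => ae_logMeanSlope_eq (ℓ := ℓ) hlaw hindep hr0.le hr1 (ht k).1.le (ht1 k)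
  have hJ0 : ∀ k, ∫ ω, (gafLogAverage ℓ a r ω - gafLogAverage ℓ a (t k) ω) ∂P = 0 := fun k => by
    rw [integral_sub (mr.integrable one_le_two) ((mt k).integrable one_le_two),
      integral_gafLogAverage hlaw hindep hr0.le hr1,
      integral_gafLogAverage hlaw hindep (ht k).1.le (ht1 k), sub_zero]
  have hmean : ∀ k, ∫ ω, logMeanSlope (hyperbolicGAF (ℓ + 1) fun n => a n ω) r (t k) ∂P =
      (gafLogMean ℓ r - gafLogMean ℓ (t k)) / (Real.log r - Real.log (t k)) := fun k => by
    rw [integral_congr_ae (hslope k), integral_div,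
      integral_add ((mJ k).integrable one_le_two) (integrable_const _), hJ0]
    simp
  -- The slope is a centred variable plus a deterministic one, so its variance is the second moment
  -- of the centred increment.
  have hsq : ∀ k, ∫ ω, logMeanSlope (hyperbolicGAF (ℓ + 1) fun n => a n ω) r (t k) ^ 2 ∂P -
      (∫ ω, logMeanSlope (hyperbolicGAF (ℓ + 1) fun n => a n ω) r (t k) ∂P) ^ 2 =
      (∫ ω, (gafLogAverage ℓ a r ω - gafLogAverage ℓ a (t k) ω) ^ 2 ∂P) /
        (Real.log r - Real.log (t k)) ^ 2 := fun k => by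
    rw [hmean]
    have h1 : ∫ ω, logMeanSlope (hyperbolicGAF (ℓ + 1) fun n => a n ω) r (t k) ^ 2 ∂P =
        ∫ ω, ((gafLogAverage ℓ a r ω - gafLogAverage ℓ a (t k) ω) ^ 2 +
          (2 * (gafLogMean ℓ r - gafLogMean ℓ (t k)) *
            (gafLogAverage ℓ a r ω - gafLogAverage ℓ a (t k) ω) +
          (gafLogMean ℓ r - gafLogMean ℓ (t k)) ^ 2)) / (Real.log r - Real.log (t k)) ^ 2 ∂P := by
      refine integral_congr_ae ((hslope k).mono fun ω h => ?_)
      simp only [h, div_pow]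
      ring
    have i1 : Integrable (fun ω => 2 * (gafLogMean ℓ r - gafLogMean ℓ (t k)) *
            (gafLogAverage ℓ a r ω - gafLogAverage ℓ a (t k) ω)) P :=
      ((mJ k).integrable one_le_two).const_mul _
    have i2 : Integrable (fun ω => 2 * (gafLogMean ℓ r - gafLogMean ℓ (t k)) *
            (gafLogAverage ℓ a r ω - gafLogAverage ℓ a (t k) ω) +
          (gafLogMean ℓ r - gafLogMean ℓ (t k)) ^ 2) P := i1.add (integrable_const _)
    rw [h1, integral_div, integral_add (mJ k).integrable_sq i2,
      integral_add i1 (integrable_const _), integral_const_mul, hJ0]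
    simp only [integral_const, probReal_univ, one_smul, div_pow]
    ring
  obtain ⟨m, hm⟩ := hasDerivAt_gafLogMean_exp (ℓ := ℓ) hlr
  refine variance_eq_of_tendsto
    (D := fun k ω => logMeanSlope (hyperbolicGAF (ℓ + 1) fun n => a n ω) r (t k))
    (fun k => ?_) (fun k => ?_) (fun k => ?_) ?_ ?_ (M := m) ?_
  · refine MemLp.ae_eq ((hslope k).mono fun ω h => h.symm) ?_
    have h : MemLp (fun ω => (gafLogAverage ℓ a r ω - gafLogAverage ℓ a (t k) ω +
        (gafLogMean ℓ r - gafLogMean ℓ (t k))) * (Real.log r - Real.log (t k))⁻¹) 2 P :=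
      ((mJ k).add (memLp_const _)).mul_const _
    simpa only [div_eq_mul_inv] using h
  · filter_upwards [hgood] with ω h
    exact (logMeanSlope_mem_Icc (ht k).1 (ht k).2 h.1 h.2).1
  · filter_upwards [hgood] with ω h
    exact (logMeanSlope_mem_Icc (ht k).1 (ht k).2 h.1 h.2).2
  · filter_upwards [hgood] with ω h
    have ht' : Tendsto t atTop (𝓝[<] r) :=
      tendsto_nhdsWithin_iff.2 ⟨htlim, Eventually.of_forall fun k => (ht k).2⟩
    exact tendsto_const_nhds.congr' ((ht'.eventually
      (eventually_logMeanSlope_eq hr0 h.1 h.2)).mono fun k hk => hk.symm)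
  · simp_rw [hsq]
    have hneg : ∀ᶠ τ in 𝓝 (Real.log r), τ < 0 := gt_mem_nhds hlr
    -- In the variable τ = log s the variances are the normalized squared increments of the
    -- coordinates, and their limit from the left is V.
    have h := tendsto_sum_sq_slope (τ₀ := Real.log r) (V := V)
      (Q := fun τ => ∫ ω, (gafLogAverage ℓ a r ω - gafLogAverage ℓ a (Real.exp τ) ω) ^ 2 ∂P)
      (hasDerivAt_chaosCoord ℓ) (hneg.mono hV) hVc
      ((hneg.filter_mono nhdsWithin_le_nhds).mono fun τ hτ => by
        have := hasSum_integral_gafLogAverage_sub_sq (ℓ := ℓ) hlaw hindep hr0 hr1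
          (Real.exp_pos τ) (Real.exp_lt_one_iff.2 hτ)
        rwa [Real.log_exp] at this)
    refine (h.comp hτ).congr fun k => ?_
    simp only [Function.comp_apply, Real.exp_log (ht k).1]
  · simp_rw [hmean]
    have h := ((hasDerivAt_iff_tendsto_slope.1 hm).mono_left
      (nhdsWithin_mono _ (fun t (ht : t < Real.log r) => ht.ne))).comp hτ
    refine h.congr fun k => ?_
    rw [Function.comp_apply, slope_def_field, Real.exp_log (ht k).1, Real.exp_log hr0,
      ← neg_sub (gafLogMean ℓ r), ← neg_sub (Real.log r), neg_div_neg_eq]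

end GAF

theorem theorem1p3 {Ω : Type*} [MeasurableSpace Ω] (P : Measure Ω) [IsProbabilityMeasure P]
    (a : ℕ → Ω → ℂ) (hlaw : ∀ n, HasLaw (a n) stdComplexNormal P) (hindep : iIndepFun a P)
    (r : ℝ) (hr0 : 0 < r) (hr1 : r < 1) :
    (MemLp (gafZeroCount 1 a r) 2 P ∧
      variance (gafZeroCount 1 a r) P = r ^ 2 / (1 - r ^ 4)) ∧
    (MemLp (gafZeroCount 2 a r) 2 P ∧
      variance (gafZeroCount 2 a r) P =
        4 * r ^ 2 / (1 - r ^ 2) * (1 / (1 + r ^ 2) - 1 / (2 * Real.sqrt (1 + r ^ 4)))) := by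
  have hlr := Real.log_neg hr0 hr1
  have hx0 : Real.exp (2 * Real.log r) = r ^ 2 := exp_two_mul_log hr0
  have hr2 : r ^ 2 < 1 := by nlinarith
  constructor
  · have h := variance_gafZeroCount (ℓ := 0) (L := 1) (by norm_num) hlaw hindep hr0 hr1
      (fun τ hτ => hasSum_chaosCoordDeriv_sq_one hτ) (by
        have h1 : 1 - Real.exp (2 * Real.log r) ^ 2 ≠ 0 := by rw [hx0]; nlinarith
        fun_prop (disch := assumption))
    rw [hx0, ← pow_mul] at h
    exact h
  · have h := variance_gafZeroCount (ℓ := 1) (L := 2) (by norm_num) hlaw hindep hr0 hr1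
      (fun τ hτ => hasSum_chaosCoordDeriv_sq_two hτ) (by
        have h1 : 1 - Real.exp (2 * Real.log r) ≠ 0 := by rw [hx0]; linarith
        have h2 : 1 + Real.exp (2 * Real.log r) ≠ 0 := by positivity
        have h3 : 2 * Real.sqrt (1 + Real.exp (2 * Real.log r) ^ 2) ≠ 0 := by positivity
        fun_prop (disch := assumption))
    rw [hx0, ← pow_mul] at h
    exact h
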